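/- For complex $q$ with $|q|<1$ put $(a;q)_n=\prod_{k=0}^{n-1}(1-aq^k)$, $(a;q)_\infty=\lim_{n\to\infty}(a;q)_n$, and $$G(q)=\sum_{n\ge 0}\frac{q^{n^2}}{(q;q)_n},\qquad H(q)=\sum_{n\ge 0}\frac{q^{n(n+1)}}{(q;q)_n},\qquad \chi(q)=(-q;q^2)_\infty,$$ $$f(a,b)=\sum_{n=-\infty}^{\infty}a^{n(n+1)/2}b^{n(n-1)/2}\quad(|ab|<1),\qquad E(q)=f(-q,-q^2)=\sum_{n=-\infty}^{\infty}(-1)^nq^{n(3n-1)/2}.$$ For positive integers $r,s$ let $$U(r,s,q)=U(r,s)=\begin{cases}G(q^r)G(q^s)+q^{(s+r)/5}H(q^r)H(q^s)&\text{if } s+r\equiv 0\pmod 5,\\ H(q^r)G(q^s)-q^{(s-r)/5}G(q^r)H(q^s)&\text{if } s-r\equiv 0\pmod 5,\end{cases}$$ so that $U(1,71)=H(q)G(q^{71})-q^{14}G(q)H(q^{71})$. For a positive definite binary quadratic form $an^2+bnm+cm^2$ write $(a,b,c)$ also for its generating function $\sum_{n,m=-\infty}^{\infty}q^{an^2+bnm+cm^2}$.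 **Theorem.** Let $|q|<1$ and $Q=q^{71}$. The following five identities hold: 1. $2q^3E(q)E(Q)=(3,1,6)-(4,3,5)$; 2. $2qE(q)E(Q)\,U(1,71)^2=(3,1,6)-(4,3,5)-(2,1,9)+(1,1,18)$; 3. $2q^2E(q)E(Q)\,U(1,71)=(2,1,9)-(3,1,6)$; 4. $2q\,U(1,71,q^2)=-2q^3+\chi(q)\chi(Q)-\chi(-q)\chi(-Q)-\dfrac{2q^9}{\chi(-q^2)\chi(-Q^2)}$; 5. $\bigl((3,1,6)-(4,3,5)-(2,1,9)+(1,1,18)\bigr)\bigl((3,1,6)-(4,3,5)\bigr)=\bigl((2,1,9)-(3,1,6)\bigr)^2$. -/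

import Mathlib

/-!
Rogers-Ramanujan functions, Ramanujan's general theta function, and generating functions of binary
quadratic forms, all as analytic functions of a complex variable `q` with `‖q‖ < 1`.
The lemmas show that the series and products used below converge, so that no junk value of `∑'`,
`∏'` or `/` enters.
-/

namespace RogersRamanujan

open Filter Topology

noncomputable section

/-- `(a; q)_n = ∏_{k=0}^{n-1} (1 - a q^k)`. -/
def qPoch (a q : ℂ) (n : ℕ) : ℂ := ∏ k ∈ Finset.range n, (1 - a * q ^ k)

/-- `(a; q)_∞ = lim_{n → ∞} (a; q)_n`, for `‖q‖ < 1`. -/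
def qPochInf (a q : ℂ) : ℂ := ∏' k : ℕ, (1 - a * q ^ k)

/-- The Rogers-Ramanujan function `G(q) = ∑_{n ≥ 0} q^{n²} / (q; q)_n`. -/
def G (q : ℂ) : ℂ := ∑' n : ℕ, q ^ (n ^ 2) / qPoch q q n

/-- The Rogers-Ramanujan function `H(q) = ∑_{n ≥ 0} q^{n(n+1)} / (q; q)_n`. -/
def H (q : ℂ) : ℂ := ∑' n : ℕ, q ^ (n * (n + 1)) / qPoch q q n

/-- Ramanujan's function `U(r, s, q)`. It is set to `0` when neither `r + s` nor `s - r` is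
divisible by `5`, where it is not defined. -/
def U (r s : ℕ) (q : ℂ) : ℂ :=
  if (5 : ℤ) ∣ (s : ℤ) + r then
    G (q ^ r) * G (q ^ s) + q ^ (((s : ℤ) + r) / 5) * (H (q ^ r) * H (q ^ s))
  else if (5 : ℤ) ∣ (s : ℤ) - r then
    H (q ^ r) * G (q ^ s) - q ^ (((s : ℤ) - r) / 5) * (G (q ^ r) * H (q ^ s))
  else 0

/-- Ramanujan's general theta function
`f(a, b) = ∑_{n ∈ ℤ} a^{n(n+1)/2} b^{n(n-1)/2}`, for `‖a * b‖ < 1`. -/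
def f (a b : ℂ) : ℂ := ∑' n : ℤ, a ^ (n * (n + 1) / 2) * b ^ (n * (n - 1) / 2)

/-- `E(q) = f(-q, -q²) = ∑_{n ∈ ℤ} (-1)^n q^{n(3n-1)/2}`. -/
def E (q : ℂ) : ℂ := f (-q) (-q ^ 2)

/-- `χ(q) = (-q; q²)_∞`. -/
def chi (q : ℂ) : ℂ := qPochInf (-q) (q ^ 2)

/-- The generating function `∑_{n, m ∈ ℤ} q^{a n² + b n m + c m²}` of the quadratic form
`(a, b, c)`, for positive definite `(a, b, c)`. -/
def form (a b c : ℤ) (q : ℂ) : ℂ :=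
  ∑' p : ℤ × ℤ, q ^ (a * p.1 ^ 2 + b * p.1 * p.2 + c * p.2 ^ 2)

/-! ### Convergence -/

theorem summable_pow_natAbs {r : ℝ} (h0 : 0 ≤ r) (h1 : r < 1) :
    Summable fun n : ℤ => r ^ n.natAbs := by
  apply Summable.of_nat_of_neg
  · simpa using summable_geometric_of_lt_one h0 h1
  · simpa using summable_geometric_of_lt_one h0 h1

theorem summable_form {a b c : ℤ} (ha : 0 < a) (hd : b ^ 2 - 4 * a * c < 0) {q : ℂ}
    (hq : ‖q‖ < 1) :
    Summable fun p : ℤ × ℤ => q ^ (a * p.1 ^ 2 + b * p.1 * p.2 + c * p.2 ^ 2) := by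
  have hc : 0 < c := by
    by_contra h
    nlinarith [sq_nonneg b, mul_nonneg ha.le (not_lt.1 h |> neg_nonneg.2)]
  obtain ⟨K, hK⟩ := Int.eq_ofNat_of_zero_le (show 0 ≤ 4 * (a + c) by omega)
  have hK0 : K ≠ 0 := by omega
  obtain ⟨r, hr0, hrK⟩ : ∃ r : ℝ, 0 ≤ r ∧ r ^ K = ‖q‖ :=
    ⟨‖q‖ ^ ((K : ℝ)⁻¹), by positivity, Real.rpow_inv_natCast_pow (norm_nonneg q) hK0⟩
  have hr1 : r < 1 := by
    by_contra h
    have := one_le_pow₀ (not_lt.1 h) (n := K)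
    linarith
  have hs := (summable_pow_natAbs hr0 hr1).mul_of_nonneg (summable_pow_natAbs hr0 hr1)
    (fun _ => by positivity) (fun _ => by positivity)
  refine Summable.of_norm_bounded hs ?_
  rintro ⟨n, m⟩
  have key : (n.natAbs : ℤ) + m.natAbs ≤ K * (a * n ^ 2 + b * n * m + c * m ^ 2) := by
    have h1 : (n.natAbs : ℤ) ≤ n ^ 2 := by
      simpa using Int.natAbs_le_self_sq n
    have h2 : (m.natAbs : ℤ) ≤ m ^ 2 := by
      simpa using Int.natAbs_le_self_sq m
    have h3 : m ^ 2 ≤ 4 * a * (a * n ^ 2 + b * n * m + c * m ^ 2) := by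
      nlinarith [sq_nonneg (2 * a * n + b * m),
        mul_nonneg (show 0 ≤ 4 * a * c - b ^ 2 - 1 by omega) (sq_nonneg m)]
    have h4 : n ^ 2 ≤ 4 * c * (a * n ^ 2 + b * n * m + c * m ^ 2) := by
      nlinarith [sq_nonneg (2 * c * m + b * n),
        mul_nonneg (show 0 ≤ 4 * a * c - b ^ 2 - 1 by omega) (sq_nonneg n)]
    have h5 : (K : ℤ) = 4 * (a + c) := hK.symm
    rw [h5]
    linarith
  have hpos : 0 ≤ a * n ^ 2 + b * n * m + c * m ^ 2 := by
    have hK' : (0 : ℤ) < K := by omega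
    by_contra h
    have := mul_neg_of_pos_of_neg hK' (not_le.1 h)
    omega
  obtain ⟨N, hN⟩ := Int.eq_ofNat_of_zero_le hpos
  simp only [hN] at key ⊢
  rw [zpow_natCast, norm_pow, ← hrK, ← pow_mul, ← pow_add]
  exact pow_le_pow_of_le_one hr0 hr1.le (by exact_mod_cast key)

theorem summable_E {q : ℂ} (hq : ‖q‖ < 1) :
    Summable fun n : ℤ => (-q) ^ (n * (n + 1) / 2) * (-q ^ 2) ^ (n * (n - 1) / 2) := by
  refine Summable.of_norm_bounded (summable_pow_natAbs (norm_nonneg q) hq) ?_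
  intro n
  have e1 : 2 * (n * (n + 1) / 2) = n * (n + 1) :=
    Int.mul_ediv_cancel' (Int.even_mul_succ_self n).two_dvd
  have e2 : 2 * (n * (n - 1) / 2) = n * (n - 1) :=
    Int.mul_ediv_cancel' (Int.even_mul_pred_self n).two_dvd
  have p1 : 0 ≤ n * (n + 1) := by
    rcases le_or_gt 0 n with h | h <;> nlinarith
  have p2 : 0 ≤ n * (n - 1) := by
    rcases lt_or_ge 0 n with h | h <;> nlinarith
  obtain ⟨A, hA⟩ := Int.eq_ofNat_of_zero_le (show 0 ≤ n * (n + 1) / 2 by omega)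
  obtain ⟨B, hB⟩ := Int.eq_ofNat_of_zero_le (show 0 ≤ n * (n - 1) / 2 by omega)
  rw [hA] at e1
  rw [hB] at e2
  have key : n.natAbs ≤ A + 2 * B := by
    zify
    rcases le_total 0 n with h | h
    · rw [abs_of_nonneg h]
      rcases h.eq_or_lt with h | h
      · subst h; positivity
      · nlinarith
    · rw [abs_of_nonpos h]; nlinarith
  rw [hA, hB, zpow_natCast, zpow_natCast, norm_mul, norm_pow, norm_pow, norm_neg, norm_neg,
    norm_pow, ← pow_mul, ← pow_add]
  exact pow_le_pow_of_le_one (norm_nonneg q) hq.le key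

theorem one_sub_pow_ne_zero {q : ℂ} (hq : ‖q‖ < 1) (k : ℕ) : 1 - q * q ^ k ≠ 0 := by
  intro h
  have h1 : ‖q * q ^ k‖ = 1 := by rw [← sub_eq_zero.1 h, norm_one]
  rw [← pow_succ', norm_pow] at h1
  exact (pow_lt_one₀ (norm_nonneg q) hq k.succ_ne_zero).ne h1

theorem qPoch_ne_zero {q : ℂ} (hq : ‖q‖ < 1) (n : ℕ) : qPoch q q n ≠ 0 :=
  Finset.prod_ne_zero_iff.2 fun k _ => one_sub_pow_ne_zero hq k

theorem summable_norm_mul_pow (a : ℂ) {q : ℂ} (hq : ‖q‖ < 1) :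
    Summable fun k : ℕ => ‖-(a * q ^ k)‖ := by
  simpa using (summable_geometric_of_lt_one (norm_nonneg q) hq).mul_left ‖a‖

theorem multipliable_qPochInf (a : ℂ) {q : ℂ} (hq : ‖q‖ < 1) :
    Multipliable fun k : ℕ => 1 - a * q ^ k := by
  simpa [sub_eq_add_neg] using multipliable_one_add_of_summable (summable_norm_mul_pow a hq)

theorem tendsto_qPoch (a : ℂ) {q : ℂ} (hq : ‖q‖ < 1) :
    Tendsto (qPoch a q) atTop (𝓝 (qPochInf a q)) :=
  (multipliable_qPochInf a hq).hasProd.tendsto_prod_nat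

theorem chi_ne_zero {q : ℂ} (hq : ‖q‖ < 1) : chi q ≠ 0 := by
  have hq2 : ‖q ^ 2‖ < 1 := by
    rw [norm_pow]; exact pow_lt_one₀ (norm_nonneg q) hq two_ne_zero
  have h := tprod_one_add_ne_zero_of_summable (f := fun k : ℕ => -(-q * (q ^ 2) ^ k)) ?_
    (summable_norm_mul_pow (-q) hq2)
  · simpa [chi, qPochInf, sub_eq_add_neg] using h
  · intro k h
    have h1 : q ^ (2 * k + 1) = -1 := by
      rw [pow_succ, pow_mul]; linear_combination h
    have h2 : ‖q‖ ^ (2 * k + 1) = 1 := by rw [← norm_pow, h1, norm_neg, norm_one]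
    exact (pow_lt_one₀ (norm_nonneg q) hq (by omega)).ne h2

/-- For fixed `q`, the reciprocals `1 / (q; q)_n` are bounded. -/
theorem exists_bound_inv_qPoch {q : ℂ} (hq : ‖q‖ < 1) :
    ∃ C : ℝ, ∀ n, ‖(qPoch q q n)⁻¹‖ ≤ C := by
  have hne : qPochInf q q ≠ 0 := by
    have h := tprod_one_add_ne_zero_of_summable (f := fun k : ℕ => -(q * q ^ k))
      (fun k => by simpa [sub_eq_add_neg] using one_sub_pow_ne_zero hq k)
      (summable_norm_mul_pow q hq)
    simpa [qPochInf, sub_eq_add_neg] using h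
  obtain ⟨C, hC⟩ := ((tendsto_qPoch q hq).inv₀ hne).norm.bddAbove_range
  exact ⟨C, fun n => hC ⟨n, rfl⟩⟩

theorem summable_pow_div_qPoch {q : ℂ} (hq : ‖q‖ < 1) {e : ℕ → ℕ} (he : ∀ n, n ≤ e n) :
    Summable fun n : ℕ => q ^ e n / qPoch q q n := by
  obtain ⟨C, hC⟩ := exists_bound_inv_qPoch hq
  refine Summable.of_norm_bounded
    ((summable_geometric_of_lt_one (norm_nonneg q) hq).mul_right C) fun n => ?_
  rw [div_eq_mul_inv, norm_mul, norm_pow]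
  exact mul_le_mul (pow_le_pow_of_le_one (norm_nonneg q) hq.le (he n)) (hC n) (norm_nonneg _)
    (by positivity)

theorem summable_G {q : ℂ} (hq : ‖q‖ < 1) :
    Summable fun n : ℕ => q ^ (n ^ 2) / qPoch q q n :=
  summable_pow_div_qPoch hq fun n => Nat.le_self_pow two_ne_zero n

theorem summable_H {q : ℂ} (hq : ‖q‖ < 1) :
    Summable fun n : ℕ => q ^ (n * (n + 1)) / qPoch q q n :=
  summable_pow_div_qPoch hq fun n => Nat.le_mul_of_pos_right n n.succ_pos

end

end RogersRamanujan

/-!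
The identities are linear relations between two kinds of lattice sums.

On the left, `E G = f(-q², -q³)` and `E H = f(-q, -q⁴)` by the Rogers-Ramanujan identities
(`E_mul_G`, `E_mul_H`), so that `E(q) E(Q)` and `E(q) E(Q) U(1, 71)` are combinations of products of
a theta series in `q` by a theta series in `Q = q⁷¹`. The same is true of `E(q) E(Q) U(1, 71)²`:
`E G²`, `E H²` and `E G H` are again single theta series (`E_mul_G_sq`, `E_mul_H_sq`,
`E_mul_G_mul_H`), the first two being instances of the quintuple product identity. After completing
squares, with `q = r^D` for `D = 24, 40, 120`, each such product is a sum of `±r^(x² + 71 y²)` over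
pairs `(x, y)` in certain residue classes (`hasSum_signedTheta_mul`).

On the right, if `a² + 71 = 4 c A`, the form `(A, a, c)` is `x² + 71 y²` on the lattice
`x ≡ a y (mod 2c)`, divided by `4 c = D` (`hasSum_classWeight`); all the forms that occur arise in
this way. Hence each of the first three identities compares two weights on
`(ℤ/Nℤ)²`, for `N = 12, 20, 60`, and the weights agree after averaging over the signs of `x` and
`y`, which is a finite verification (`eq_zero_of_signs`). The two quintuple products are proved in the
same way, with the form `3 x² + y²` and its automorphism group of order twelve
(`eq_zero_of_hexagonalSum`).

For the fourth identity, `χ(-x) E(x²) = E(x)` turns all terms, multiplied by `q³ E(q²) E(Q²)`, into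
differences of forms at `±q`, `q²` and `q⁴`, and what remains is the splitting of the even part of a
form into forms of the same discriminant (`form_add_form_neg`). The fifth follows from the first
three.

The Jacobi triple product (`f_eq_prod`) is the limit of its finite form, proved by induction. The
Rogers-Ramanujan identities come from comparing two solutions of
`a m = a (m + 1) + q^(m + 1) a (m + 2)`, namely `(q; q)_∞ ∑ q^(n(n+m)) / (q; q)_n` and the series of
Rogers and Selberg, which have the same limit as `m → ∞`.
-/

open Filter Topology

namespace RogersRamanujan

noncomputable section

/-! ### Infinite products -/

theorem qPochInf_ne_zero {q : ℂ} (hq : ‖q‖ < 1) : qPochInf q q ≠ 0 := by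
  have h := tprod_one_add_ne_zero_of_summable (f := fun k : ℕ => -(q * q ^ k))
    (fun k => by simpa [sub_eq_add_neg] using one_sub_pow_ne_zero hq k)
    (summable_norm_mul_pow q hq)
  simpa [qPochInf, sub_eq_add_neg] using h

theorem qPoch_succ (a q : ℂ) (n : ℕ) : qPoch a q (n + 1) = qPoch a q n * (1 - a * q ^ n) :=
  Finset.prod_range_succ _ _

theorem norm_pow_lt_one {q : ℂ} (hq : ‖q‖ < 1) {n : ℕ} (hn : n ≠ 0) : ‖q ^ n‖ < 1 := by
  rw [norm_pow]
  exact pow_lt_one₀ (norm_nonneg q) hq hn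

theorem qPoch_mul_eq_prod (a q : ℂ) (N n : ℕ) :
    qPoch a q (N * n) = ∏ i ∈ Finset.range N, qPoch (a * q ^ i) (q ^ N) n := by
  induction n with
  | zero => simp [qPoch]
  | succ n ih =>
    simp_rw [qPoch_succ, Finset.prod_mul_distrib, ← ih]
    rw [Nat.mul_succ, qPoch, Finset.prod_range_add]
    refine congrArg _ (Finset.prod_congr rfl fun i _ => ?_)
    ring

/-- The factors of `(a; q)_∞`, sorted by the residue of the exponent modulo `N`. -/
theorem qPochInf_eq_prod (a : ℂ) {q : ℂ} (hq : ‖q‖ < 1) {N : ℕ} (hN : N ≠ 0) :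
    qPochInf a q = ∏ i ∈ Finset.range N, qPochInf (a * q ^ i) (q ^ N) := by
  have h1 : Tendsto (fun n => qPoch a q (N * n)) atTop (𝓝 (qPochInf a q)) :=
    (tendsto_qPoch a hq).comp (tendsto_id.const_mul_atTop' (Nat.pos_of_ne_zero hN))
  have h2 : Tendsto (fun n => ∏ i ∈ Finset.range N, qPoch (a * q ^ i) (q ^ N) n) atTop
      (𝓝 (∏ i ∈ Finset.range N, qPochInf (a * q ^ i) (q ^ N))) :=
    tendsto_finsetProd _ fun i _ => tendsto_qPoch _ (norm_pow_lt_one hq hN)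
  simp_rw [← qPoch_mul_eq_prod] at h2
  exact tendsto_nhds_unique h1 h2

/-! ### The Jacobi triple product -/

/-- The term `a^{k(k+1)/2} b^{k(k-1)/2}` of the theta series `f a b`. -/
def thetaTerm (a b : ℂ) (k : ℤ) : ℂ := a ^ (k * (k + 1) / 2) * b ^ (k * (k - 1) / 2)

theorem thetaTerm_swap (a b : ℂ) (k : ℤ) : thetaTerm a b (-k) = thetaTerm b a k := by
  rw [thetaTerm, thetaTerm, mul_comm, show -k * (-k - 1) = k * (k + 1) by ring,
    show -k * (-k + 1) = k * (k - 1) by ring]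

theorem f_comm (a b : ℂ) : f a b = f b a := by
  rw [f, ← (Equiv.neg ℤ).tsum_eq]
  exact tsum_congr fun k => thetaTerm_swap a b k

theorem thetaTerm_succ {a b : ℂ} (ha : a ≠ 0) (hb : b ≠ 0) (k : ℤ) :
    thetaTerm a b (k + 1) = a * (a * b) ^ k * thetaTerm a b k := by
  have e1 : (k + 1) * (k + 1 + 1) / 2 = k * (k + 1) / 2 + (k + 1) := by
    rw [show (k + 1) * (k + 1 + 1) = k * (k + 1) + (k + 1) * 2 by ring,
      Int.add_mul_ediv_right _ _ two_ne_zero]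
  have e2 : (k + 1) * (k + 1 - 1) / 2 = k * (k - 1) / 2 + k := by
    rw [show (k + 1) * (k + 1 - 1) = k * (k - 1) + k * 2 by ring,
      Int.add_mul_ediv_right _ _ two_ne_zero]
  rw [thetaTerm, thetaTerm, e1, e2, zpow_add₀ ha, zpow_add₀ ha, zpow_add₀ hb, mul_zpow, zpow_one]
  ring

theorem summable_norm_thetaTerm {a b : ℂ} (ha : ‖a‖ < 1) (hb : ‖b‖ < 1) :
    Summable fun k : ℤ => ‖thetaTerm a b k‖ := by
  refine Summable.of_nonneg_of_le (fun _ => norm_nonneg _) ?_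
    (summable_pow_natAbs (le_max_of_le_left (norm_nonneg a) : 0 ≤ max ‖a‖ ‖b‖) (max_lt ha hb))
  intro k
  have e1 : 2 * (k * (k + 1) / 2) = k * (k + 1) :=
    Int.mul_ediv_cancel' (Int.even_mul_succ_self k).two_dvd
  have e2 : 2 * (k * (k - 1) / 2) = k * (k - 1) :=
    Int.mul_ediv_cancel' (Int.even_mul_pred_self k).two_dvd
  have p1 : 0 ≤ k * (k + 1) := by rcases le_or_gt 0 k with h | h <;> nlinarith
  have p2 : 0 ≤ k * (k - 1) := by rcases lt_or_ge 0 k with h | h <;> nlinarith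
  obtain ⟨A, hA⟩ := Int.eq_ofNat_of_zero_le (show 0 ≤ k * (k + 1) / 2 by omega)
  obtain ⟨B, hB⟩ := Int.eq_ofNat_of_zero_le (show 0 ≤ k * (k - 1) / 2 by omega)
  rw [hA] at e1
  rw [hB] at e2
  have key : k.natAbs ≤ A + B := by
    have := Int.natAbs_le_self_sq k
    zify at this ⊢
    nlinarith
  rw [thetaTerm, hA, hB, zpow_natCast, zpow_natCast, norm_mul, norm_pow, norm_pow]
  have h0 : 0 ≤ max ‖a‖ ‖b‖ := le_max_of_le_left (norm_nonneg a)
  calc ‖a‖ ^ A * ‖b‖ ^ B ≤ max ‖a‖ ‖b‖ ^ A * max ‖a‖ ‖b‖ ^ B := by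
        gcongr
        · exact le_max_left _ _
        · exact le_max_right _ _
    _ = max ‖a‖ ‖b‖ ^ (A + B) := (pow_add _ _ _).symm
    _ ≤ _ := pow_le_pow_of_le_one h0 (max_lt ha hb).le key

theorem hasSum_f {a b : ℂ} (ha : ‖a‖ < 1) (hb : ‖b‖ < 1) : HasSum (thetaTerm a b) (f a b) :=
  (summable_norm_thetaTerm ha hb).of_norm.hasSum

/-- `1 / (p; p)_j`, with the usual convention that it vanishes for negative `j`. -/
def invPoch (p : ℂ) (j : ℤ) : ℂ := if j < 0 then 0 else (qPoch p p j.toNat)⁻¹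

theorem invPoch_sub_one {p : ℂ} (hp : ‖p‖ < 1) (j : ℤ) :
    invPoch p (j - 1) = (1 - p ^ j) * invPoch p j := by
  rcases lt_trichotomy j 0 with h | rfl | h
  · simp [invPoch, h, show j < 1 by omega]
  · simp [invPoch]
  · obtain ⟨n, rfl⟩ : ∃ n : ℕ, j = n + 1 := ⟨(j - 1).toNat, by omega⟩
    have h1 : ¬ ((n : ℤ) < 0) := by omega
    have h2 : ¬ ((n : ℤ) + 1 < 0) := by omega
    have h3 : ((n : ℤ) + 1).toNat = n + 1 := by omega
    have h4 : p ^ ((n : ℤ) + 1) = p * p ^ n := by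
      rw [← pow_succ']; exact_mod_cast zpow_natCast p (n + 1)
    have h5 := one_sub_pow_ne_zero hp n
    rw [invPoch, invPoch, add_sub_cancel_right, if_neg h1, if_neg h2, h3, h4, qPoch_succ,
      Int.toNat_natCast]
    field_simp

theorem exists_bound_invPoch {p : ℂ} (hp : ‖p‖ < 1) : ∃ C : ℝ, 0 ≤ C ∧ ∀ j, ‖invPoch p j‖ ≤ C := by
  obtain ⟨C, hC⟩ := exists_bound_inv_qPoch hp
  have hC0 : 0 ≤ C := (norm_nonneg _).trans (hC 0)
  refine ⟨C, hC0, fun j => ?_⟩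
  rw [invPoch]
  split_ifs
  · simpa using hC0
  · exact hC _

theorem tendsto_invPoch {p : ℂ} (hp : ‖p‖ < 1) (k : ℤ) :
    Tendsto (fun n : ℕ => invPoch p (n + k)) atTop (𝓝 (qPochInf p p)⁻¹) := by
  have h1 : Tendsto (fun n : ℕ => ((n : ℤ) + k).toNat) atTop atTop := by
    refine tendsto_atTop.2 fun b => ?_
    filter_upwards [eventually_ge_atTop (b + k.natAbs)] with n hn
    omega
  refine (((tendsto_qPoch p hp).comp h1).inv₀ (qPochInf_ne_zero hp)).congr' ?_
  filter_upwards [eventually_ge_atTop k.natAbs] with n hn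
  rw [invPoch, if_neg (by omega)]
  rfl

/-- The finite form of the Jacobi triple product, of which the theorem is the limit `m, n → ∞`;
the sum runs over `-n ≤ k ≤ m`, the coefficients being Gaussian binomials. -/
def FiniteTriple (a b : ℂ) (m n : ℕ) : Prop :=
  HasSum (fun k : ℤ => invPoch (a * b) (n + k) * invPoch (a * b) (m - k) * thetaTerm a b k)
    (qPoch (-a) (a * b) m * qPoch (-b) (a * b) n * (qPoch (a * b) (a * b) (m + n))⁻¹)

theorem FiniteTriple.symm {a b : ℂ} {m n : ℕ} (h : FiniteTriple a b m n) :
    FiniteTriple b a n m := by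
  have h := (Equiv.neg ℤ).hasSum_iff.2 h
  rw [FiniteTriple, mul_comm b a, mul_comm (qPoch (-b) _ _), add_comm n m]
  refine h.congr_fun fun k => ?_
  simp only [Function.comp_apply, Equiv.neg_apply, thetaTerm_swap, sub_neg_eq_add, ← sub_eq_add_neg]
  ring

theorem FiniteTriple.succ {a b : ℂ} (ha : a ≠ 0) (hb : b ≠ 0) (hp : ‖a * b‖ < 1) {m n : ℕ}
    (h : FiniteTriple a b m n) : FiniteTriple a b (m + 1) n := by
  have hp0 : a * b ≠ 0 := mul_ne_zero ha hb
  have h1 := ((Equiv.subRight (1 : ℤ)).hasSum_iff.2 h).mul_left (a * (a * b) ^ m)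
  have hne := one_sub_pow_ne_zero hp (m + n)
  have h2 := (h.add h1).mul_right (1 - a * b * (a * b) ^ (m + n))⁻¹
  rw [FiniteTriple]
  refine (h2.congr_fun fun k => ?_).trans_eq ?_
  · simp only [Function.comp_apply, Equiv.subRight_apply]
    obtain ⟨k, rfl⟩ : ∃ l, k = l + 1 := ⟨k - 1, by ring⟩
    have e1 := invPoch_sub_one hp (n + (k + 1))
    have e2 := invPoch_sub_one hp (m - k)
    have e3 : (a * b) ^ m * (a * b) ^ n * (a * b) =
        (a * b) ^ (m - k) * (a * b) ^ (n + (k + 1)) := by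
      rw [← zpow_add₀ hp0, show (m - k + (n + (k + 1)) : ℤ) = ((m + n + 1 : ℕ) : ℤ) by
        push_cast; ring, zpow_natCast]
      ring
    have e4 : (a * b) ^ m = (a * b) ^ (m - k) * (a * b) ^ k := by
      rw [← zpow_add₀ hp0, sub_add_cancel, zpow_natCast]
    rw [show (n + (k + 1) - 1 : ℤ) = n + k by ring] at e1
    rw [show (m - k - 1 : ℤ) = m - (k + 1) by ring] at e2
    rw [eq_mul_inv_iff_mul_eq₀ hne, add_sub_cancel_right, e1, e2, thetaTerm_succ ha hb,
      show ((m + 1 : ℕ) : ℤ) - (k + 1) = m - k by push_cast; ring, pow_add]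
    linear_combination (-invPoch (a * b) (n + (k + 1)) * invPoch (a * b) (m - k) *
      (a * (a * b) ^ k * thetaTerm a b k)) * e3 - a * thetaTerm a b k *
      invPoch (a * b) (n + (k + 1)) * invPoch (a * b) (m - k) * (1 - (a * b) ^ (n + (k + 1))) * e4
  · rw [add_right_comm, qPoch_succ, qPoch_succ, mul_inv]
    ring_nf

theorem finiteTriple {a b : ℂ} (ha : a ≠ 0) (hb : b ≠ 0) (hp : ‖a * b‖ < 1) (m n : ℕ) :
    FiniteTriple a b m n := by
  induction m with
  | zero =>
    refine FiniteTriple.symm ?_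
    rw [mul_comm] at hp
    induction n with
    | zero =>
      have h := hasSum_single (f := fun k : ℤ => invPoch (b * a) ((0 : ℕ) + k) *
        invPoch (b * a) ((0 : ℕ) - k) * thetaTerm b a k) 0 fun k hk => by
          rcases lt_or_gt_of_ne hk with h | h <;> simp [invPoch, h]
      simpa [FiniteTriple, invPoch, qPoch, thetaTerm] using h
    | succ n ih => exact ih.succ hb ha hp
  | succ m ih => exact ih.succ ha hb hp

/-- The Jacobi triple product. -/
theorem f_eq_prod {a b : ℂ} (ha0 : a ≠ 0) (hb0 : b ≠ 0) (ha : ‖a‖ < 1) (hb : ‖b‖ < 1) :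
    f a b = qPochInf (a * b) (a * b) * qPochInf (-a) (a * b) * qPochInf (-b) (a * b) := by
  have hp : ‖a * b‖ < 1 := by
    rw [norm_mul]; exact mul_lt_one_of_nonneg_of_lt_one_left (norm_nonneg a) ha hb.le
  obtain ⟨C, hC0, hC⟩ := exists_bound_invPoch hp
  have hne := qPochInf_ne_zero hp
  have hL : Tendsto (fun n : ℕ => ∑' k : ℤ, invPoch (a * b) (n + k) * invPoch (a * b) (n - k) *
      thetaTerm a b k) atTop
      (𝓝 (∑' k : ℤ, (qPochInf (a * b) (a * b))⁻¹ * (qPochInf (a * b) (a * b))⁻¹ *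
        thetaTerm a b k)) := by
    refine tendsto_tsum_of_dominated_convergence (bound := fun k => C * C * ‖thetaTerm a b k‖)
      ((summable_norm_thetaTerm ha hb).mul_left _) (fun k => ?_)
      (Eventually.of_forall fun n k => ?_)
    · refine ((tendsto_invPoch hp k).mul ?_).mul_const _
      simpa only [sub_eq_add_neg] using tendsto_invPoch hp (-k)
    · rw [norm_mul, norm_mul]
      gcongr
      · exact hC _
      · exact hC _
  have hR : Tendsto (fun n : ℕ => qPoch (-a) (a * b) n * qPoch (-b) (a * b) n *
      (qPoch (a * b) (a * b) (n + n))⁻¹) atTop (𝓝 (qPochInf (-a) (a * b) * qPochInf (-b) (a * b) *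
        (qPochInf (a * b) (a * b))⁻¹)) :=
    ((tendsto_qPoch _ hp).mul (tendsto_qPoch _ hp)).mul
      (((tendsto_qPoch _ hp).comp (tendsto_id.atTop_add_atTop tendsto_id)).inv₀ hne)
  have h := tendsto_nhds_unique hL (hR.congr fun n => (finiteTriple ha0 hb0 hp n n).tsum_eq.symm)
  rw [tsum_mul_left, (hasSum_f ha hb).tsum_eq] at h
  field_simp at h
  rw [h]

/-! ### Product formulas for theta functions -/

theorem E_eq_qPochInf {q : ℂ} (hq0 : q ≠ 0) (hq : ‖q‖ < 1) : E q = qPochInf q q := by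
  have h2 : ‖-q ^ 2‖ < 1 := by rw [norm_neg]; exact norm_pow_lt_one hq two_ne_zero
  rw [E, f_eq_prod (by simpa) (by simpa) (by rwa [norm_neg]) h2,
    qPochInf_eq_prod q hq three_ne_zero]
  simp only [Finset.prod_range_succ, Finset.prod_range_zero, neg_neg]
  ring_nf

theorem E_ne_zero {q : ℂ} (hq0 : q ≠ 0) (hq : ‖q‖ < 1) : E q ≠ 0 :=
  E_eq_qPochInf hq0 hq ▸ qPochInf_ne_zero hq

/-- `(x; x²)_∞ (x²; x²)_∞ = (x; x)_∞`. -/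
theorem chi_neg_mul_E_sq {x : ℂ} (hx0 : x ≠ 0) (hx : ‖x‖ < 1) : chi (-x) * E (x ^ 2) = E x := by
  rw [E_eq_qPochInf hx0 hx, E_eq_qPochInf (pow_ne_zero 2 hx0) (norm_pow_lt_one hx two_ne_zero),
    qPochInf_eq_prod x hx two_ne_zero, chi]
  simp only [Finset.prod_range_succ, Finset.prod_range_zero, neg_neg]
  ring_nf

theorem f_two_three_mul_f_one_four {q : ℂ} (hq0 : q ≠ 0) (hq : ‖q‖ < 1) :
    f (-q ^ 2) (-q ^ 3) * f (-q) (-q ^ 4) = E q * E (q ^ 5) := by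
  have h (n : ℕ) (hn : n ≠ 0) : ‖-q ^ n‖ < 1 := by rw [norm_neg]; exact norm_pow_lt_one hq hn
  rw [f_eq_prod (by simpa) (by simpa) (h 2 (by simp)) (h 3 (by simp)),
    f_eq_prod (by simpa) (by simpa) (by rwa [norm_neg]) (h 4 (by simp)), E_eq_qPochInf hq0 hq,
    E_eq_qPochInf (pow_ne_zero 5 hq0) (norm_pow_lt_one hq (by simp)),
    qPochInf_eq_prod q hq (show 5 ≠ 0 by simp)]
  simp only [Finset.prod_range_succ, Finset.prod_range_zero, neg_neg]
  ring_nf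

/-! ### The Rogers-Ramanujan identities -/

/-- The series `∑ q^{n(n+m)} / (q; q)_n`, which is `G(q)` for `m = 0` and `H(q)` for `m = 1`. -/
def rrSeries (q : ℂ) (m : ℕ) : ℂ := ∑' n : ℕ, q ^ (n * (n + m)) / qPoch q q n

theorem G_eq_rrSeries (q : ℂ) : G q = rrSeries q 0 := by
  simp only [G, rrSeries, sq, add_zero]

theorem H_eq_rrSeries (q : ℂ) : H q = rrSeries q 1 := rfl

theorem summable_rrSeries {q : ℂ} (hq : ‖q‖ < 1) (m : ℕ) :
    Summable fun n : ℕ => q ^ (n * (n + m)) / qPoch q q n :=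
  summable_pow_div_qPoch hq fun n =>
    (Nat.le_mul_self n).trans (Nat.mul_le_mul_left n (n.le_add_right m))

theorem rrSeries_eq_add {q : ℂ} (hq : ‖q‖ < 1) (m : ℕ) :
    rrSeries q m = rrSeries q (m + 1) + q ^ (m + 1) * rrSeries q (m + 2) := by
  have hs := (summable_rrSeries hq m).sub (summable_rrSeries hq (m + 1))
  have h := (summable_rrSeries hq m).tsum_sub (summable_rrSeries hq (m + 1))
  rw [hs.tsum_eq_zero_add] at h
  rw [← sub_eq_iff_eq_add', rrSeries, rrSeries, ← h, rrSeries, ← tsum_mul_left]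
  simp only [zero_mul, sub_self, zero_add]
  refine tsum_congr fun k => ?_
  have h1 := one_sub_pow_ne_zero hq k
  have h2 := qPoch_ne_zero hq k
  rw [qPoch_succ]
  field_simp
  ring

theorem tendsto_rrSeries {q : ℂ} (hq : ‖q‖ < 1) : Tendsto (rrSeries q) atTop (𝓝 1) := by
  obtain ⟨C, hC⟩ := exists_bound_inv_qPoch hq
  have h : Tendsto (rrSeries q) atTop (𝓝 (∑' n : ℕ, if n = 0 then 1 else 0)) := by
    refine tendsto_tsum_of_dominated_convergence (bound := fun n => ‖q‖ ^ n * C)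
      ((summable_geometric_of_lt_one (norm_nonneg q) hq).mul_right C) (fun n => ?_)
      (Eventually.of_forall fun m n => ?_)
    · rcases eq_or_ne n 0 with rfl | hn
      · simp [qPoch]
      · have h1 : Tendsto (fun m => n * (n + m)) atTop atTop :=
          tendsto_atTop_mono (fun m => show m ≤ n * (n + m) by
            nlinarith [Nat.one_le_iff_ne_zero.2 hn, Nat.zero_le m]) tendsto_id
        simpa [hn] using
          ((tendsto_pow_atTop_nhds_zero_of_norm_lt_one hq).comp h1).div_const (qPoch q q n)
    · rw [div_eq_mul_inv, norm_mul, norm_pow]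
      exact mul_le_mul (pow_le_pow_of_le_one (norm_nonneg q) hq.le
        ((Nat.le_mul_self n).trans (Nat.mul_le_mul_left n (n.le_add_right m)))) (hC n)
        (norm_nonneg _) (by positivity)
  simpa using h

/-- A sequence tending to `0` that satisfies the recurrence of the Rogers-Ramanujan series
vanishes: going down the recurrence multiplies its size by at most `∏ (1 + ‖q‖^(m+1))`. -/
theorem eq_zero_of_recurrence {q : ℂ} (hq : ‖q‖ < 1) {D : ℕ → ℂ}
    (hD : ∀ m, D m = D (m + 1) + q ^ (m + 2) * D (m + 2)) (h0 : Tendsto D atTop (𝓝 0)) (m : ℕ) :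
    D m = 0 := by
  set M : ℕ → ℝ := fun m => max ‖D m‖ ‖D (m + 1)‖ with hM
  have hM0 (m) : 0 ≤ M m := le_max_of_le_left (norm_nonneg _)
  have step (m) : M m ≤ Real.exp (‖q‖ ^ m) * M (m + 1) := by
    have h1 : 1 + ‖q‖ ^ m ≤ Real.exp (‖q‖ ^ m) := by
      rw [add_comm]; exact Real.add_one_le_exp _
    have h2 : ‖D (m + 1)‖ ≤ M (m + 1) := le_max_left _ _
    have h3 : ‖D (m + 2)‖ ≤ M (m + 1) := le_max_right _ _
    have h4 : 0 ≤ ‖q‖ ^ m := by positivity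
    refine le_trans ?_ (mul_le_mul_of_nonneg_right h1 (hM0 _))
    refine max_le ?_ (by nlinarith [mul_nonneg h4 (hM0 (m + 1))])
    calc ‖D m‖ ≤ ‖D (m + 1)‖ + ‖q ^ (m + 2) * D (m + 2)‖ := by
          rw [hD m]; exact norm_add_le _ _
      _ ≤ M (m + 1) + ‖q‖ ^ m * M (m + 1) := by
          rw [norm_mul, norm_pow]
          exact add_le_add h2 (mul_le_mul (pow_le_pow_of_le_one (norm_nonneg q) hq.le
            (Nat.le_add_right m 2)) h3 (norm_nonneg _) h4)
      _ = _ := by ring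
  have iter (n) : M m ≤ Real.exp (∑ j ∈ Finset.range n, ‖q‖ ^ (m + j)) * M (m + n) := by
    induction n with
    | zero => simp
    | succ n ih =>
      rw [Finset.sum_range_succ, Real.exp_add, mul_assoc]
      exact ih.trans (mul_le_mul_of_nonneg_left (step _) (Real.exp_pos _).le)
  have hsum (n) : ∑ j ∈ Finset.range n, ‖q‖ ^ (m + j) ≤ ∑' j : ℕ, ‖q‖ ^ j := by
    refine le_trans (Finset.sum_le_sum fun j _ =>
      pow_le_pow_of_le_one (norm_nonneg q) hq.le (show j ≤ m + j by omega)) ?_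
    exact (summable_geometric_of_lt_one (norm_nonneg q) hq).sum_le_tsum _
      fun _ _ => by positivity
  have hlim : Tendsto (fun n => Real.exp (∑' j : ℕ, ‖q‖ ^ j) * M (m + n)) atTop (𝓝 0) := by
    have h1 : Tendsto M atTop (𝓝 0) := by
      simpa using h0.norm.max ((tendsto_add_atTop_iff_nat 1).2 h0).norm
    simpa using (h1.comp (tendsto_add_atTop_nat m)).const_mul (Real.exp (∑' j : ℕ, ‖q‖ ^ j))
      |>.congr fun n => by simp [add_comm]
  have : M m ≤ 0 := ge_of_tendsto' hlim fun n => (iter n).trans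
    (mul_le_mul_of_nonneg_right (Real.exp_le_exp.2 (hsum n)) (hM0 _))
  exact norm_le_zero_iff.1 ((le_max_left _ _).trans this)

/-- `(-1)^k q^{k(5k-1)/2}`, as a product. -/
def rrSign (q : ℂ) (k : ℕ) : ℂ := ∏ j ∈ Finset.range k, -q ^ (5 * j + 2)

theorem rrSign_succ (q : ℂ) (k : ℕ) : rrSign q (k + 1) = rrSign q k * -q ^ (5 * k + 2) :=
  Finset.prod_range_succ _ _

theorem norm_rrSign_le {q : ℂ} (hq : ‖q‖ < 1) (k : ℕ) : ‖rrSign q k‖ ≤ ‖q‖ ^ k := by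
  rw [rrSign, norm_prod]
  refine (Finset.prod_le_prod (g := fun _ => ‖q‖) (fun _ _ => norm_nonneg _) fun j _ => ?_).trans_eq
    (by simp)
  rw [norm_neg, norm_pow]
  exact pow_le_of_le_one (norm_nonneg q) hq.le (by omega)

/-- The factor `(-1)^k q^{2(m+1)k + k(5k-1)/2} (q; q)_{m+k} / (q; q)_k`. -/
def rrCoeff (q : ℂ) (m k : ℕ) : ℂ :=
  rrSign q k * q ^ (2 * (m + 1) * k) * (qPoch q q (m + k) / qPoch q q k)

/-- The series of Rogers and Selberg, which equals `(q; q)_∞ ∑ q^{n(n+m+1)} / (q; q)_n`. -/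
def selbergSeries (q : ℂ) (m : ℕ) : ℂ := ∑' k : ℕ, rrCoeff q m k * (1 - q ^ (m + 1 + 2 * k))

theorem norm_one_sub_pow_le {q : ℂ} (hq : ‖q‖ < 1) (n : ℕ) : ‖1 - q ^ n‖ ≤ 2 := by
  refine (norm_sub_le _ _).trans ?_
  rw [norm_one, norm_pow]
  linarith [pow_le_one₀ (n := n) (norm_nonneg q) hq.le]

theorem exists_bound_rrCoeff {q : ℂ} (hq : ‖q‖ < 1) :
    ∃ C : ℝ, 0 ≤ C ∧ ∀ m k, ‖rrCoeff q m k‖ ≤ C * ‖q‖ ^ k := by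
  obtain ⟨C, hC⟩ := exists_bound_inv_qPoch hq
  obtain ⟨K, hK⟩ := (tendsto_qPoch q hq).norm.bddAbove_range
  have hC0 : 0 ≤ C := (norm_nonneg _).trans (hC 0)
  have hK0 : 0 ≤ K := (norm_nonneg _).trans (hK ⟨0, rfl⟩)
  refine ⟨K * C, by positivity, fun m k => ?_⟩
  rw [rrCoeff, div_eq_mul_inv, norm_mul, norm_mul, norm_mul, norm_pow]
  calc ‖rrSign q k‖ * ‖q‖ ^ (2 * (m + 1) * k) * (‖qPoch q q (m + k)‖ * ‖(qPoch q q k)⁻¹‖)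
      ≤ ‖q‖ ^ k * 1 * (K * C) := by
        gcongr
        · exact norm_rrSign_le hq k
        · exact pow_le_one₀ (norm_nonneg q) hq.le
        · exact hK ⟨_, rfl⟩
        · exact hC k
    _ = _ := by ring

theorem summable_selbergSeries {q : ℂ} (hq : ‖q‖ < 1) (m : ℕ) :
    Summable fun k : ℕ => rrCoeff q m k * (1 - q ^ (m + 1 + 2 * k)) := by
  obtain ⟨C, hC0, hC⟩ := exists_bound_rrCoeff hq
  refine Summable.of_norm_bounded (g := fun k => C * ‖q‖ ^ k * 2)
    (((summable_geometric_of_lt_one (norm_nonneg q) hq).mul_left C).mul_right 2) fun k => ?_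
  rw [norm_mul]
  exact mul_le_mul (hC m k) (norm_one_sub_pow_le hq _) (norm_nonneg _) (by positivity)

/-- The sum of a telescoping series whose terms `g k` tend to `0`. -/
theorem HasSum.eq_neg_of_telescope {t g : ℕ → ℂ} {a : ℂ} (h : HasSum t a)
    (ht : ∀ k, t k = g (k + 1) - g k) (hg : Tendsto g atTop (𝓝 0)) : a = -g 0 := by
  have h1 := h.tendsto_sum_nat
  simp_rw [ht, Finset.sum_range_sub] at h1
  simpa using tendsto_nhds_unique h1 (hg.sub_const (g 0))

theorem tendsto_zero_of_norm_le_geometric {q : ℂ} (hq : ‖q‖ < 1) {g : ℕ → ℂ} {C : ℝ}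
    (h : ∀ k, ‖g k‖ ≤ C * ‖q‖ ^ k) : Tendsto g atTop (𝓝 0) :=
  squeeze_zero_norm h
    (by simpa using (tendsto_pow_atTop_nhds_zero_of_lt_one (norm_nonneg q) hq).const_mul C)

theorem selbergSeries_eq_add {q : ℂ} (hq : ‖q‖ < 1) (m : ℕ) :
    selbergSeries q m = selbergSeries q (m + 1) + q ^ (m + 2) * selbergSeries q (m + 2) := by
  have hs := ((summable_selbergSeries hq m).hasSum.sub
    (summable_selbergSeries hq (m + 1)).hasSum).sub
    ((summable_selbergSeries hq (m + 2)).hasSum.mul_left (q ^ (m + 2)))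
  -- With `X = q^k` and `Z = q^(m+1)`, the terms of this combination are the differences of
  -- `-rrCoeff q m k * (1 - X) (1 + X - Z X²)`.
  have key := HasSum.eq_neg_of_telescope hs (g := fun k => -(rrCoeff q m k * (1 - q ^ k) *
    (1 + q ^ k - q ^ (m + 1 + 2 * k)))) (fun k => ?_) ?_
  · rw [pow_zero, sub_self] at key
    simp only [mul_zero, zero_mul, neg_zero] at key
    rw [selbergSeries, selbergSeries, selbergSeries]
    linear_combination key
  · have h1 := one_sub_pow_ne_zero hq k
    have h2 := qPoch_ne_zero hq k
    simp only [rrCoeff, rrSign_succ, show m + 1 + k = m + k + 1 by ring,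
      show m + 2 + k = m + k + 1 + 1 by ring, ← add_assoc, qPoch_succ]
    rw [show q ^ (2 * (m + 1 + 1) * k) = q ^ (2 * (m + 1) * k) * (q ^ k) ^ 2 by ring,
      show q ^ (2 * (m + 2 + 1) * k) = q ^ (2 * (m + 1) * k) * (q ^ k) ^ 4 by ring,
      show q ^ (2 * (m + 1) * (k + 1)) = q ^ (2 * (m + 1) * k) * (q ^ m) ^ 2 * q ^ 2 by ring]
    generalize q ^ (2 * (m + 1) * k) = Y
    simp only [pow_add, pow_mul, mul_add, mul_comm 2 k, mul_comm 5 k]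
    generalize rrSign q k = T
    generalize qPoch q q (m + k) = V at *
    generalize qPoch q q k = W at *
    generalize q ^ k = X at *
    generalize q ^ m = Z at *
    field_simp
    ring
  · obtain ⟨C, hC0, hC⟩ := exists_bound_rrCoeff hq
    refine tendsto_zero_of_norm_le_geometric hq (C := C * 2 * 3) fun k => ?_
    have h3 : ‖1 + q ^ k - q ^ (m + 1 + 2 * k)‖ ≤ 3 := by
      rw [add_comm, add_sub_assoc]
      refine (norm_add_le _ _).trans ?_
      rw [norm_pow]
      linarith [pow_le_one₀ (n := k) (norm_nonneg q) hq.le, norm_one_sub_pow_le hq (m + 1 + 2 * k)]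
    rw [norm_neg, norm_mul, norm_mul]
    calc _ ≤ (C * ‖q‖ ^ k) * 2 * 3 := by
          gcongr
          · exact hC m k
          · exact norm_one_sub_pow_le hq k
      _ = _ := by ring

theorem tendsto_selbergSeries {q : ℂ} (hq : ‖q‖ < 1) :
    Tendsto (selbergSeries q) atTop (𝓝 (qPochInf q q)) := by
  obtain ⟨C, hC0, hC⟩ := exists_bound_rrCoeff hq
  have h : Tendsto (selbergSeries q) atTop (𝓝 (∑' k : ℕ, if k = 0 then qPochInf q q else 0)) := by
    refine tendsto_tsum_of_dominated_convergence (bound := fun k => C * ‖q‖ ^ k * 2)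
      (((summable_geometric_of_lt_one (norm_nonneg q) hq).mul_left C).mul_right 2) (fun k => ?_)
      (Eventually.of_forall fun m k => ?_)
    · have h1 : Tendsto (fun m => q ^ (m + 1 + 2 * k)) atTop (𝓝 0) := by
        simp_rw [add_assoc]
        exact (tendsto_add_atTop_iff_nat (1 + 2 * k)).2
          (tendsto_pow_atTop_nhds_zero_of_norm_lt_one hq)
      have h2 : Tendsto (fun m => qPoch q q (m + k)) atTop (𝓝 (qPochInf q q)) :=
        (tendsto_add_atTop_iff_nat k).2 (tendsto_qPoch q hq)
      have h3 : Tendsto (fun m => 1 - q ^ (m + 1 + 2 * k)) atTop (𝓝 1) := by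
        simpa using h1.const_sub 1
      rcases eq_or_ne k 0 with rfl | hk
      · simpa [rrCoeff, rrSign, qPoch] using h2.mul h3
      · have h4 : Tendsto (fun m => q ^ (2 * (m + 1) * k)) atTop (𝓝 0) :=
          (tendsto_pow_atTop_nhds_zero_of_norm_lt_one hq).comp
            (tendsto_atTop_mono (fun m => show m ≤ 2 * (m + 1) * k by
              nlinarith [Nat.one_le_iff_ne_zero.2 hk, Nat.zero_le m]) tendsto_id)
        simpa [rrCoeff, hk] using
          ((h4.const_mul (rrSign q k)).mul (h2.div_const (qPoch q q k))).mul h3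
    · rw [norm_mul]
      exact mul_le_mul (hC m k) (norm_one_sub_pow_le hq _) (norm_nonneg _) (by positivity)
  simpa using h

theorem qPochInf_mul_rrSeries {q : ℂ} (hq : ‖q‖ < 1) (m : ℕ) :
    qPochInf q q * rrSeries q (m + 1) = selbergSeries q m := by
  refine sub_eq_zero.1 (eq_zero_of_recurrence hq
    (D := fun m => qPochInf q q * rrSeries q (m + 1) - selbergSeries q m) (fun m => ?_) ?_ m)
  · rw [rrSeries_eq_add hq, selbergSeries_eq_add hq]
    ring
  · simpa using (((tendsto_add_atTop_iff_nat 1).2 (tendsto_rrSeries hq)).const_mul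
      (qPochInf q q)).sub
      (tendsto_selbergSeries hq)

theorem thetaTerm_two_three {q : ℂ} (hq0 : q ≠ 0) (k : ℕ) :
    thetaTerm (-q ^ 2) (-q ^ 3) k = rrSign q k := by
  induction k with
  | zero => simp [thetaTerm, rrSign]
  | succ k ih =>
    push_cast
    rw [thetaTerm_succ (by simpa) (by simpa), ih, rrSign_succ, zpow_natCast]
    ring

theorem thetaTerm_three_two {q : ℂ} (hq0 : q ≠ 0) (k : ℕ) :
    thetaTerm (-q ^ 3) (-q ^ 2) k = rrSign q k * q ^ k := by
  induction k with
  | zero => simp [thetaTerm, rrSign]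
  | succ k ih =>
    push_cast
    rw [thetaTerm_succ (by simpa) (by simpa), ih, rrSign_succ, zpow_natCast]
    ring

theorem thetaTerm_four_one {q : ℂ} (hq0 : q ≠ 0) (k : ℕ) :
    thetaTerm (-q ^ 4) (-q) k = rrSign q k * q ^ (2 * k) := by
  induction k with
  | zero => simp [thetaTerm, rrSign]
  | succ k ih =>
    push_cast
    rw [thetaTerm_succ (by simpa) (by simpa), ih, rrSign_succ, zpow_natCast]
    ring

theorem thetaTerm_one_four {q : ℂ} (hq0 : q ≠ 0) (k : ℕ) :
    thetaTerm (-q) (-q ^ 4) (k + 1) = -(rrSign q k * q ^ (4 * k + 1)) := by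
  induction k with
  | zero => simp [thetaTerm, rrSign]
  | succ k ih =>
    rw [thetaTerm_succ (by simpa) (by simpa), show (((k + 1 : ℕ) : ℤ)) = k + 1 by push_cast; rfl,
      ih, rrSign_succ, show ((k : ℤ) + 1) = ((k + 1 : ℕ) : ℤ) by push_cast; rfl, zpow_natCast]
    ring

theorem summable_rrSign {q : ℂ} (hq : ‖q‖ < 1) (i : ℕ) :
    Summable fun k : ℕ => rrSign q k * q ^ (i * k) := by
  refine Summable.of_norm_bounded (summable_geometric_of_lt_one (norm_nonneg q) hq) fun k => ?_
  rw [norm_mul, norm_pow]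
  exact (mul_le_of_le_one_right (norm_nonneg _) (pow_le_one₀ (norm_nonneg q) hq.le)).trans
    (norm_rrSign_le hq k)

/-- The second Rogers-Ramanujan identity. -/
theorem E_mul_H {q : ℂ} (hq0 : q ≠ 0) (hq : ‖q‖ < 1) : E q * H q = f (-q) (-q ^ 4) := by
  have h4 : ‖-q ^ 4‖ < 1 := by rw [norm_neg]; exact norm_pow_lt_one hq (by simp)
  have hs := hasSum_f h4 (by rwa [norm_neg] : ‖-q‖ < 1)
  have h1 : HasSum (fun k : ℕ => thetaTerm (-q ^ 4) (-q) k + thetaTerm (-q ^ 4) (-q) (-(k + 1)))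
      (f (-q ^ 4) (-q)) := hs.nat_add_neg_add_one
  rw [E_eq_qPochInf hq0 hq, H_eq_rrSeries, qPochInf_mul_rrSeries hq, f_comm, ← h1.tsum_eq]
  refine tsum_congr fun k => ?_
  have h2 := qPoch_ne_zero hq k
  rw [thetaTerm_swap, thetaTerm_four_one hq0, thetaTerm_one_four hq0, rrCoeff, zero_add, zero_add,
    div_self h2]
  ring

/-- The first Rogers-Ramanujan identity. -/
theorem E_mul_G {q : ℂ} (hq0 : q ≠ 0) (hq : ‖q‖ < 1) : E q * G q = f (-q ^ 2) (-q ^ 3) := by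
  have h (n : ℕ) (hn : n ≠ 0) : ‖-q ^ n‖ < 1 := by rw [norm_neg]; exact norm_pow_lt_one hq hn
  have hT := (summable_rrSign hq 0).hasSum
  have hT1 := (summable_rrSign hq 1).hasSum
  simp only [zero_mul, pow_zero, mul_one, one_mul] at hT hT1
  have hf : f (-q ^ 2) (-q ^ 3) = ∑' k, rrSign q k + ∑' k, rrSign q k * q ^ k - 1 := by
    refine (hasSum_f (h 2 (by simp)) (h 3 (by simp))).unique ?_
    have := HasSum.of_nat_of_neg (f := thetaTerm (-q ^ 2) (-q ^ 3))
      (hT.congr_fun fun k => thetaTerm_two_three hq0 k)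
      (hT1.congr_fun fun k => by rw [thetaTerm_swap, thetaTerm_three_two hq0])
    simpa [thetaTerm] using this
  have hs := ((hT.add hT1).sub (summable_selbergSeries hq 0).hasSum).sub
    ((summable_selbergSeries hq 1).hasSum.mul_left q)
  -- The same telescoping as in `selbergSeries_eq_add`, with `m + 1` replaced by `0`: the factor
  -- `(q; q)_{k-1} (1 - q^k) / (q; q)_k` is cancelled, so the initial value is `-1` and not `0`.
  have key := HasSum.eq_neg_of_telescope hs
    (g := fun k => -(rrSign q k * (1 + q ^ k - q ^ (2 * k)))) (fun k => ?_) ?_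
  · rw [E_eq_qPochInf hq0 hq, G_eq_rrSeries, rrSeries_eq_add hq, hf]
    have e1 := qPochInf_mul_rrSeries hq 0
    have e2 := qPochInf_mul_rrSeries hq 1
    simp only [zero_add, pow_one, one_add_one_eq_two] at e1 e2 ⊢
    rw [mul_add, mul_left_comm, e1, e2, selbergSeries, selbergSeries]
    have h0 : rrSign q 0 = 1 := by simp [rrSign]
    simp only [h0, zero_add, one_add_one_eq_two, pow_zero, mul_zero, one_mul,
      neg_neg] at key
    linear_combination -key
  · have h1 := one_sub_pow_ne_zero hq k
    have h2 := qPoch_ne_zero hq k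
    simp only [rrCoeff, rrSign_succ, zero_add, add_comm 1 k, qPoch_succ, div_self h2]
    field_simp
    ring
  · refine tendsto_zero_of_norm_le_geometric hq (C := 3) fun k => ?_
    have h3 : ‖1 + q ^ k - q ^ (2 * k)‖ ≤ 3 := by
      rw [add_comm, add_sub_assoc]
      refine (norm_add_le _ _).trans ?_
      rw [norm_pow]
      linarith [pow_le_one₀ (n := k) (norm_nonneg q) hq.le, norm_one_sub_pow_le hq (2 * k)]
    rw [norm_neg, norm_mul, mul_comm]
    exact mul_le_mul h3 (norm_rrSign_le hq k) (norm_nonneg _) (by simp)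

/-! ### Theta series with periodic weights -/

/-- The term of index `p` in the generating function of the quadratic form `(a, b, c)`. -/
def formTerm (a b c : ℤ) (r : ℂ) (p : ℤ × ℤ) : ℂ :=
  r ^ (a * p.1 ^ 2 + b * p.1 * p.2 + c * p.2 ^ 2)

theorem hasSum_form {a b c : ℤ} (ha : 0 < a) (hd : b ^ 2 - 4 * a * c < 0) {q : ℂ} (hq : ‖q‖ < 1) :
    HasSum (formTerm a b c q) (form a b c q) :=
  (summable_form ha hd hq).hasSum

/-- The theta series `∑ (-1)^n r^{(M n + a)²}`. -/
def signedTheta (M a : ℤ) (r : ℂ) : ℂ := ∑' n : ℤ, (-1) ^ n * r ^ ((M * n + a) ^ 2)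

theorem pow_mul_thetaTerm {r : ℂ} (hr : r ≠ 0) (i j : ℕ) (n : ℤ) :
    r ^ (((i : ℤ) - j) ^ 2) * thetaTerm (-(r ^ (8 * (i + j))) ^ i) (-(r ^ (8 * (i + j))) ^ j) n =
      (-1) ^ n * r ^ ((2 * ((i : ℤ) + j) * n + (i - j)) ^ 2) := by
  obtain ⟨k, hk⟩ : (2 : ℤ) ∣ n * (n - 1) := (Int.even_mul_pred_self n).two_dvd
  have e1 : n * (n + 1) / 2 = k + n := by
    rw [show n * (n + 1) = (k + n) * 2 by linear_combination hk, Int.mul_ediv_cancel _ two_ne_zero]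
  have e2 : n * (n - 1) / 2 = k := by
    rw [hk, Int.mul_ediv_cancel_left _ two_ne_zero]
  have h1 : (-1 : ℂ) ≠ 0 := by norm_num
  have hsign : (-1 : ℂ) ^ (k + n) * (-1) ^ k = (-1) ^ n := by
    rw [← zpow_add₀ h1, show k + n + k = 2 * k + n by ring, zpow_add₀ h1, zpow_mul]
    norm_num
  rw [thetaTerm, e1, e2, neg_eq_neg_one_mul, neg_eq_neg_one_mul ((r ^ (8 * (i + j))) ^ j), mul_zpow,
    mul_zpow, ← hsign]
  simp only [← zpow_natCast, ← zpow_mul]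
  rw [show (2 * ((i : ℤ) + j) * n + (i - j)) ^ 2 = (i - j) ^ 2 +
      (((8 * (i + j) : ℕ) : ℤ) * i * (k + n) + ((8 * (i + j) : ℕ) : ℤ) * j * k) by
    push_cast
    linear_combination 4 * ((i : ℤ) + j) ^ 2 * hk, zpow_add₀ hr, zpow_add₀ hr]
  ring

/-- Completing the square in the exponent of a theta series. -/
theorem pow_mul_f {r : ℂ} (hr : r ≠ 0) (i j : ℕ) :
    r ^ (((i : ℤ) - j) ^ 2) * f (-(r ^ (8 * (i + j))) ^ i) (-(r ^ (8 * (i + j))) ^ j) =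
      signedTheta (2 * ((i : ℤ) + j)) (i - j) r := by
  rw [f, signedTheta, ← tsum_mul_left]
  exact tsum_congr fun n => pow_mul_thetaTerm hr i j n

/-- The weight `1` on the residue class of `a`, and `-1` on that of `a + M`. With `s ≠ 1` the
classes are taken modulo a proper divisor of `N`: `s * x = s * a` in `ZMod N` says that `x` and
`a` agree modulo `N / s`. -/
def signWeight (N s : ℕ) (M a : ℤ) (x : ZMod N) : ℤ :=
  if (s : ZMod N) * x = s * a then 1 else if (s : ZMod N) * x = s * (a + M) then -1 else 0

theorem mul_eq_mul_iff_dvd {N s : ℕ} {M : ℤ} (hs : s ≠ 0) (hN : (N : ℤ) = s * (2 * M)) (x a : ℤ) :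
    (s : ZMod N) * x = s * a ↔ 2 * M ∣ x - a := by
  rw [← sub_eq_zero, ← mul_sub, show (s : ZMod N) * (x - a) = ((s * (x - a) : ℤ) : ZMod N) by
    push_cast; ring, ZMod.intCast_zmod_eq_zero_iff_dvd, hN]
  exact mul_dvd_mul_iff_left (by exact_mod_cast hs)

theorem signWeight_intCast {N s : ℕ} {M : ℤ} (hs : s ≠ 0) (hN : (N : ℤ) = s * (2 * M)) (a x : ℤ) :
    signWeight N s M a x = if 2 * M ∣ x - a then 1 else if 2 * M ∣ x - (a + M) then -1 else 0 := by
  have h := mul_eq_mul_iff_dvd hs hN x (a + M)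
  push_cast at h
  simp only [signWeight, mul_eq_mul_iff_dvd hs hN x a, h]

theorem signWeight_progression {N s : ℕ} {M : ℤ} (hs : s ≠ 0) (hN : (N : ℤ) = s * (2 * M))
    (hM : M ≠ 0) (a n : ℤ) : (signWeight N s M a ((M * n + a : ℤ) : ZMod N) : ℂ) = (-1) ^ n := by
  rw [signWeight_intCast hs hN]
  rcases Int.even_or_odd' n with ⟨k, rfl | rfl⟩
  · rw [if_pos ⟨k, by ring⟩, zpow_mul]
    norm_num
  · rw [if_neg, if_pos ⟨k, by ring⟩, zpow_add₀ (by norm_num), zpow_mul]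
    · norm_num
    · rintro ⟨l, hl⟩
      have : M * (2 * (k - l) + 1) = 0 := by linear_combination hl
      rcases mul_eq_zero.1 this with h | h
      · exact hM h
      · omega

theorem exists_of_signWeight_ne_zero {N s : ℕ} {M : ℤ} (hs : s ≠ 0) (hN : (N : ℤ) = s * (2 * M))
    {a x : ℤ} (h : signWeight N s M a x ≠ 0) : ∃ n, M * n + a = x := by
  rw [signWeight_intCast hs hN] at h
  split_ifs at h with h1 h2
  · obtain ⟨k, hk⟩ := h1
    exact ⟨2 * k, by linear_combination -hk⟩
  · obtain ⟨k, hk⟩ := h2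
    exact ⟨2 * k + 1, by linear_combination -hk⟩
  · exact absurd rfl h

theorem signWeight_eq_zero_of_not_odd {N s : ℕ} {M : ℤ} (hs : s ≠ 0) (hN : (N : ℤ) = s * (2 * M))
    (hM : Even M) {a x : ℤ} (ha : Odd a) (hx : ¬ Odd x) : signWeight N s M a x = 0 := by
  by_contra h
  obtain ⟨n, rfl⟩ := exists_of_signWeight_ne_zero hs hN h
  exact hx ((hM.mul_right n).add_odd ha)

/-- `signedTheta M a` as a sum over all integers, weighted by `signWeight`. -/
theorem hasSum_signedTheta {N s : ℕ} {M : ℤ} (hs : s ≠ 0) (hN : (N : ℤ) = s * (2 * M))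
    (hM : M ≠ 0) (a : ℤ) {r : ℂ} (hr : ‖r‖ < 1) :
    HasSum (fun x : ℤ => (signWeight N s M a x : ℂ) * r ^ (x ^ 2)) (signedTheta M a r) ∧
      Summable fun x : ℤ => ‖(signWeight N s M a x : ℂ) * r ^ (x ^ 2)‖ := by
  have hn : Summable fun x : ℤ => ‖(signWeight N s M a x : ℂ) * r ^ (x ^ 2)‖ := by
    refine Summable.of_nonneg_of_le (fun _ => norm_nonneg _) (fun x => ?_)
      (summable_pow_natAbs (norm_nonneg r) hr)
    have h1 : ‖(signWeight N s M a x : ℂ)‖ ≤ 1 := by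
      rw [signWeight]; split_ifs <;> simp
    have h2 : ‖r ^ (x ^ 2)‖ ≤ ‖r‖ ^ x.natAbs := by
      rw [← Int.natAbs_sq, ← Nat.cast_pow, zpow_natCast, norm_pow]
      exact pow_le_pow_of_le_one (norm_nonneg r) hr.le (Nat.le_self_pow two_ne_zero _)
    rw [norm_mul]
    exact (mul_le_of_le_one_left (norm_nonneg _) h1).trans h2
  refine ⟨?_, hn⟩
  have hinj : Function.Injective fun n : ℤ => M * n + a := fun m n h =>
    mul_left_cancel₀ hM (add_right_cancel h)
  have h : signedTheta M a r = ∑' x : ℤ, (signWeight N s M a x : ℂ) * r ^ (x ^ 2) := by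
    rw [← hinj.tsum_eq, signedTheta]
    · exact tsum_congr fun n => by rw [signWeight_progression hs hN hM]
    · intro x hx
      refine exists_of_signWeight_ne_zero hs hN fun h0 => hx ?_
      simp [h0]
  rw [h]
  exact hn.of_norm.hasSum

theorem hasSum_signedTheta_mul {N s t : ℕ} {M M' : ℤ} (hs : s ≠ 0) (ht : t ≠ 0)
    (hN : (N : ℤ) = s * (2 * M)) (hN' : (N : ℤ) = t * (2 * M')) (hM : M ≠ 0) (hM' : M' ≠ 0)
    (a b : ℤ) {r : ℂ} (hr : ‖r‖ < 1) {α β : ℕ} (hα : α ≠ 0) (hβ : β ≠ 0) (hr0 : r ≠ 0) :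
    HasSum (fun p : ℤ × ℤ => ((signWeight N s M a p.1 * signWeight N t M' b p.2 : ℤ) : ℂ) *
      formTerm α 0 β r p) (signedTheta M a (r ^ α) * signedTheta M' b (r ^ β)) := by
  obtain ⟨h1, h2⟩ := hasSum_signedTheta hs hN hM a (norm_pow_lt_one hr hα)
  obtain ⟨h3, h4⟩ := hasSum_signedTheta ht hN' hM' b (norm_pow_lt_one hr hβ)
  have h5 := (summable_mul_of_summable_norm h2 h4).hasSum
  rw [← tsum_mul_tsum_of_summable_norm h2 h4, h1.tsum_eq, h3.tsum_eq] at h5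
  refine h5.congr_fun fun p => ?_
  have e1 : (r ^ α) ^ (p.1 ^ 2) = r ^ ((α : ℤ) * p.1 ^ 2) := by rw [zpow_mul, zpow_natCast]
  have e2 : (r ^ β) ^ (p.2 ^ 2) = r ^ ((β : ℤ) * p.2 ^ 2) := by rw [zpow_mul, zpow_natCast]
  rw [e1, e2, formTerm, zero_mul, zero_mul, add_zero, zpow_add₀ hr0, Int.cast_mul]
  exact mul_mul_mul_comm _ _ _ _

/-! ### Binary quadratic forms -/

theorem form_swap (a b c : ℤ) (q : ℂ) : form a b c q = form c b a q := by
  rw [form, ← (Equiv.prodComm ℤ ℤ).tsum_eq, form]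
  refine tsum_congr fun p => ?_
  simp only [Equiv.prodComm_apply, Prod.fst_swap, Prod.snd_swap]
  congr 1; ring

theorem form_neg (a b c : ℤ) (q : ℂ) : form a (-b) c q = form a b c q := by
  rw [form, ← ((Equiv.refl ℤ).prodCongr (Equiv.neg ℤ)).tsum_eq, form]
  refine tsum_congr fun p => ?_
  simp only [Equiv.prodCongr_apply, Prod.map, Equiv.refl_apply, Equiv.neg_apply]
  congr 1; ring

/-- The shear `(n, m) ↦ (n + k m, m)`. -/
def shear (k : ℤ) : ℤ × ℤ ≃ ℤ × ℤ where
  toFun p := (p.1 + k * p.2, p.2)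
  invFun p := (p.1 - k * p.2, p.2)
  left_inv p := by simp
  right_inv p := by simp

/-- The effect of `n ↦ n + k m` on the coefficients. -/
theorem form_shear (k a b c : ℤ) (q : ℂ) :
    form a (b + 2 * a * k) (a * k ^ 2 + b * k + c) q = form a b c q := by
  rw [form, form, ← (shear k).tsum_eq fun p : ℤ × ℤ =>
    q ^ (a * p.1 ^ 2 + b * p.1 * p.2 + c * p.2 ^ 2)]
  refine tsum_congr fun p => ?_
  simp only [shear, Equiv.coe_fn_mk]
  congr 1; ring

/-- The indicator of the congruence `x = a y`. -/
def classWeight {N : ℕ} (a : ℤ) (x y : ZMod N) : ℤ := if x = a * y then 1 else 0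

/-- If `a² + 71 = 4 c A`, the lattice `x ≡ a y (mod 2c)` with the form `x² + 71 y²` is, up to the
factor `4 c`, the lattice `ℤ²` with the form `(A, a, c)`. -/
theorem hasSum_classWeight {c : ℕ} {A a : ℤ} (hc : 0 < c) (h : a ^ 2 + 71 = 4 * c * A)
    {r : ℂ} (hr : ‖r‖ < 1) :
    HasSum (fun p : ℤ × ℤ => ((classWeight (N := 2 * c) a p.1 p.2 : ℤ) : ℂ) * formTerm 1 0 71 r p)
      (form A a c (r ^ (4 * c))) := by
  have hc' : (0 : ℤ) < c := by exact_mod_cast hc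
  have hA : 0 < A := by
    by_contra hA
    nlinarith [sq_nonneg a, mul_nonneg hc'.le (neg_nonneg.2 (not_lt.1 hA))]
  let g : ℤ × ℤ → ℤ × ℤ := fun p => (a * p.1 + 2 * c * p.2, p.1)
  have hg : Function.Injective g := by
    rintro ⟨n, m⟩ ⟨n', m'⟩ h
    simp only [g, Prod.mk.injEq] at h
    obtain ⟨h1, rfl⟩ := h
    have : m = m' := mul_left_cancel₀ (show 2 * (c : ℤ) ≠ 0 by positivity) (add_left_cancel h1)
    rw [this]
  have hw (x y : ℤ) : (x : ZMod (2 * c)) = a * y ↔ 2 * (c : ℤ) ∣ x - a * y := by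
    rw [← sub_eq_zero, show (x : ZMod (2 * c)) - a * y = ((x - a * y : ℤ) : ZMod (2 * c)) by
      push_cast; ring, ZMod.intCast_zmod_eq_zero_iff_dvd]
    push_cast
    rfl
  refine (hg.hasSum_iff fun p hp => ?_).1
    ((hasSum_form hA (by linarith) (norm_pow_lt_one hr (by omega))).congr_fun fun p => ?_)
  · rw [classWeight, if_neg, Int.cast_zero, zero_mul]
    rw [hw]
    rintro ⟨k, hk⟩
    exact hp ⟨(p.2, k), Prod.ext (by simp only [g]; linarith) rfl⟩
  · simp only [Function.comp_apply, g, formTerm]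
    rw [classWeight, if_pos ((hw _ _).2 ⟨p.2, by ring⟩), Int.cast_one, one_mul, ← zpow_natCast,
      ← zpow_mul]
    congr 1
    push_cast
    linear_combination p.1 ^ 2 * h

/-! ### Averaging over automorphisms of a lattice -/

theorem HasSum.comp_automorphism {w : ℤ × ℤ → ℂ} {c : ℤ × ℤ → ℤ} {S : ℂ}
    (h : HasSum (fun p => (c p : ℂ) * w p) S) (g : ℤ × ℤ ≃ ℤ × ℤ) (hg : ∀ p, w (g p) = w p) :
    HasSum (fun p => (c (g p) : ℂ) * w p) S :=
  (g.hasSum_iff.2 h).congr_fun fun p => by simp [hg]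

/-- A weighted sum over the lattice of `x² + 71 y²` vanishes if the average of its weights over
the sign changes does. -/
theorem eq_zero_of_signs {N : ℕ} {d : ZMod N → ZMod N → ℤ} {r S : ℂ}
    (h : HasSum (fun p : ℤ × ℤ => (d p.1 p.2 : ℂ) * formTerm 1 0 71 r p) S)
    (hd : ∀ x y, d x y + d (-x) y + d x (-y) + d (-x) (-y) = 0) : S = 0 := by
  have h1 := HasSum.comp_automorphism (c := fun p => d p.1 p.2) h
    ((Equiv.neg ℤ).prodCongr (Equiv.refl ℤ)) fun p => by simp [formTerm]
  have h2 := HasSum.comp_automorphism (c := fun p => d p.1 p.2) h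
    ((Equiv.refl ℤ).prodCongr (Equiv.neg ℤ)) fun p => by simp [formTerm]
  have h3 := HasSum.comp_automorphism (c := fun p => d p.1 p.2) h
    ((Equiv.neg ℤ).prodCongr (Equiv.neg ℤ)) fun p => by simp [formTerm]
  have h4 := (((h.add h1).add h2).add h3).unique (hasSum_zero.congr_fun fun p => ?_)
  · linear_combination h4 / 4
  · rw [← add_mul, ← add_mul, ← add_mul]
    simp only [Equiv.prodCongr_apply, Prod.map, Equiv.refl_apply, Equiv.neg_apply, Int.cast_neg]
    exact_mod_cast mul_eq_zero_of_left (by exact_mod_cast hd p.1 p.2) _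

/-- The rotation of order six of the lattice with form `u² + u v + v²`. -/
def rotation : ℤ × ℤ ≃ ℤ × ℤ where
  toFun p := (p.1 + p.2, -p.1)
  invFun p := (-p.2, p.1 + p.2)
  left_inv p := by simp
  right_inv p := by simp

/-- A reflection of the lattice with form `u² + u v + v²`. -/
def reflection : ℤ × ℤ ≃ ℤ × ℤ where
  toFun p := (-p.1, p.1 + p.2)
  invFun p := (-p.1, p.1 + p.2)
  left_inv p := by simp
  right_inv p := by simp

/-- The sum of the weights over the orbit under the automorphism group, of order twelve, of the
form `u² + u v + v²`. -/
def hexagonalSum {N : ℕ} (d : ZMod N → ZMod N → ℤ) (u v : ZMod N) : ℤ :=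
  let e := fun u v => d u v + d (-u) (u + v)
  e u v + e (u + v) (-u) + e v (-u - v) + e (-u) (-v) + e (-u - v) u + e (-v) (u + v)

theorem eq_zero_of_hexagonalSum {N : ℕ} {d : ZMod N → ZMod N → ℤ} {r S : ℂ}
    (h : HasSum (fun p : ℤ × ℤ => (d p.1 p.2 : ℂ) * formTerm 4 4 4 r p) S)
    (hd : ∀ u v, hexagonalSum d u v = 0) : S = 0 := by
  have hrot (p) : formTerm 4 4 4 r (rotation p) = formTerm 4 4 4 r p := by
    simp only [formTerm, rotation, Equiv.coe_fn_mk]; congr 1; ring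
  have hrefl (p) : formTerm 4 4 4 r (reflection p) = formTerm 4 4 4 r p := by
    simp only [formTerm, reflection, Equiv.coe_fn_mk]; congr 1; ring
  have h' := h.add (HasSum.comp_automorphism (c := fun p => d p.1 p.2) h reflection hrefl)
  let e : ℤ × ℤ → ℤ := fun p => d p.1 p.2 + d (-p.1) (p.1 + p.2)
  have h0 : HasSum (fun p => (e p : ℂ) * formTerm 4 4 4 r p) (S + S) :=
    h'.congr_fun fun p => by simp [e, reflection, add_mul]
  have h1 := HasSum.comp_automorphism h0 rotation hrot
  have h2 := HasSum.comp_automorphism (c := fun p => e (rotation p)) h1 rotation hrot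
  have h3 := HasSum.comp_automorphism (c := fun p => e (rotation (rotation p))) h2 rotation hrot
  have h4 := HasSum.comp_automorphism
    (c := fun p => e (rotation (rotation (rotation p)))) h3 rotation hrot
  have h5 := HasSum.comp_automorphism
    (c := fun p => e (rotation (rotation (rotation (rotation p))))) h4 rotation hrot
  have h6 := (((((h0.add h1).add h2).add h3).add h4).add h5).unique
    (hasSum_zero.congr_fun fun p => ?_)
  · linear_combination h6 / 12
  · have h7 := hd p.1 p.2
    simp only [← add_mul]
    refine mul_eq_zero_of_left ?_ _
    simp only [e, rotation, Equiv.coe_fn_mk]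
    norm_cast
    rw [← h7, hexagonalSum]
    push_cast
    ring_nf

/-- Substituting `(x, y) = (u, u + 2 v)`, a sum over the odd points for the form `3 x² + y²`
becomes a sum over the hexagonal lattice. -/
theorem hasSum_hexagonal {N : ℕ} {d : ZMod N → ZMod N → ℤ} {r S : ℂ}
    (h : HasSum (fun p : ℤ × ℤ => (d p.1 p.2 : ℂ) * formTerm 3 0 1 r p) S)
    (hd : ∀ x y : ℤ, d x y ≠ 0 → Odd x ∧ Odd y) :
    HasSum (fun p : ℤ × ℤ => (d p.1 (p.1 + 2 * p.2) : ℂ) * formTerm 4 4 4 r p) S := by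
  let g : ℤ × ℤ → ℤ × ℤ := fun p => (p.1, p.1 + 2 * p.2)
  have hg : Function.Injective g := by
    rintro ⟨n, m⟩ ⟨n', m'⟩ h
    simp only [g, Prod.mk.injEq] at h
    exact Prod.ext h.1 (by simp only; omega)
  refine ((hg.hasSum_iff fun p hp => ?_).2 h).congr_fun fun p => ?_
  · by_cases h0 : d p.1 p.2 = 0
    · simp [h0]
    · obtain ⟨⟨k, hk⟩, ⟨l, hl⟩⟩ := hd _ _ h0
      exact absurd ⟨(p.1, l - k), Prod.ext rfl (by simp only [g]; omega)⟩ hp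
  · simp only [Function.comp_apply, g, formTerm]
    push_cast
    congr 2
    ring

/-! ### Theta series in a root of `q` -/

theorem exists_root {q : ℂ} (hq0 : q ≠ 0) (hq : ‖q‖ < 1) {n : ℕ} (hn : 0 < n) :
    ∃ r : ℂ, r ≠ 0 ∧ ‖r‖ < 1 ∧ r ^ n = q := by
  obtain ⟨r, rfl⟩ := IsAlgClosed.exists_pow_nat_eq q hn
  refine ⟨r, fun h => hq0 (by rw [h, zero_pow hn.ne']), ?_, rfl⟩
  rw [norm_pow] at hq
  exact (pow_lt_one_iff_of_nonneg (norm_nonneg r) hn.ne').1 hq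

theorem signedTheta_six {r : ℂ} (hr : r ≠ 0) : signedTheta 6 (-1) r = r * E (r ^ 24) := by
  have h := pow_mul_f hr 1 2
  norm_num at h
  exact h.symm

theorem signedTheta_ten_neg_one {r : ℂ} (hr : r ≠ 0) :
    signedTheta 10 (-1) r = r * f (-(r ^ 40) ^ 2) (-(r ^ 40) ^ 3) := by
  have h := pow_mul_f hr 2 3
  norm_num [-neg_mul] at h
  exact h.symm

theorem signedTheta_ten_neg_three {r : ℂ} (hr : r ≠ 0) :
    signedTheta 10 (-3) r = r ^ 9 * f (-r ^ 40) (-(r ^ 40) ^ 4) := by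
  have h := pow_mul_f hr 1 4
  norm_num at h
  exact_mod_cast h.symm

theorem signedTheta_thirty_neg_one {r : ℂ} (hr : r ≠ 0) :
    signedTheta 30 (-1) r = r * f (-(r ^ 120) ^ 7) (-(r ^ 120) ^ 8) := by
  have h := pow_mul_f hr 7 8
  norm_num at h
  exact_mod_cast h.symm

theorem signedTheta_thirty_neg_eleven {r : ℂ} (hr : r ≠ 0) :
    signedTheta 30 (-11) r = r ^ 121 * f (-(r ^ 120) ^ 2) (-(r ^ 120) ^ 13) := by
  have h := pow_mul_f hr 2 13
  norm_num at h
  exact_mod_cast h.symm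

theorem signedTheta_thirty_neg_seven {r : ℂ} (hr : r ≠ 0) :
    signedTheta 30 (-7) r = r ^ 49 * f (-(r ^ 120) ^ 4) (-(r ^ 120) ^ 11) := by
  have h := pow_mul_f hr 4 11
  norm_num at h
  exact_mod_cast h.symm

theorem signedTheta_thirty_neg_thirteen {r : ℂ} (hr : r ≠ 0) :
    signedTheta 30 (-13) r = r ^ 169 * f (-r ^ 120) (-(r ^ 120) ^ 14) := by
  have h := pow_mul_f hr 1 14
  norm_num at h
  exact_mod_cast h.symm

theorem signedTheta_thirty_neg_five {r : ℂ} (hr : r ≠ 0) :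
    signedTheta 30 (-5) r = r ^ 25 * E ((r ^ 120) ^ 5) := by
  have h := pow_mul_f hr 5 10
  norm_num at h
  rw [E, ← pow_mul (r ^ 120)]
  exact_mod_cast h.symm

/-! ### Products of two Rogers-Ramanujan functions -/

/-- The theta series equal to `E(q) G(q)²`. -/
def thetaGG (q : ℂ) : ℂ := f (-q ^ 7) (-q ^ 8) + q * f (-q ^ 2) (-q ^ 13)

/-- The theta series equal to `E(q) H(q)²`. -/
def thetaHH (q : ℂ) : ℂ := f (-q ^ 4) (-q ^ 11) - q * f (-q) (-q ^ 14)

theorem mul_thetaGG {r : ℂ} (hr : r ≠ 0) :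
    r * thetaGG (r ^ 120) = signedTheta 30 (-1) r + signedTheta 30 (-11) r := by
  rw [signedTheta_thirty_neg_one hr, signedTheta_thirty_neg_eleven hr, thetaGG]
  ring

theorem mul_thetaHH {r : ℂ} (hr : r ≠ 0) :
    r ^ 49 * thetaHH (r ^ 120) = signedTheta 30 (-7) r - signedTheta 30 (-13) r := by
  rw [signedTheta_thirty_neg_seven hr, signedTheta_thirty_neg_thirteen hr, thetaHH]
  ring

/-- The weights of `thetaGG`. -/
def weightGG (x : ZMod 60) : ℤ := signWeight 60 1 30 (-1) x + signWeight 60 1 30 (-11) x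

/-- The weights of `thetaHH`. -/
def weightHH (x : ZMod 60) : ℤ := signWeight 60 1 30 (-7) x - signWeight 60 1 30 (-13) x

/-- The weights of `f (-q²) (-q³) E(q⁵) - f (-q) (-q⁴) thetaGG q`. -/
def quintupleWeightG (x y : ZMod 60) : ℤ :=
  signWeight 60 3 10 (-1) x * signWeight 60 1 30 (-5) y - signWeight 60 3 10 (-3) x * weightGG y

/-- The weights of `f (-q) (-q⁴) E(q⁵) - f (-q²) (-q³) thetaHH q`. -/
def quintupleWeightH (x y : ZMod 60) : ℤ :=
  signWeight 60 3 10 (-3) x * signWeight 60 1 30 (-5) y - signWeight 60 3 10 (-1) x * weightHH y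

theorem hexagonalSum_quintupleWeightG (u v : ZMod 60) :
    hexagonalSum (fun x y => quintupleWeightG x (x + 2 * y)) u v = 0 := by
  revert u v
  decide +kernel

theorem hexagonalSum_quintupleWeightH (u v : ZMod 60) :
    hexagonalSum (fun x y => quintupleWeightH x (x + 2 * y)) u v = 0 := by
  revert u v
  decide +kernel

theorem odd_of_signWeight_combination {a b c d e : ℤ} (ha : Odd a) (hb : Odd b) (hc : Odd c)
    (hd : Odd d) (he : Odd e) {s : ℤ} {x y : ℤ}
    (h : signWeight 60 3 10 a x * signWeight 60 1 30 c y - signWeight 60 3 10 b x *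
      (signWeight 60 1 30 d y + s * signWeight 60 1 30 e y) ≠ 0) : Odd x ∧ Odd y := by
  have h10 : Even (10 : ℤ) := by decide
  have h30 : Even (30 : ℤ) := by decide
  constructor
  · by_contra hx
    refine h ?_
    rw [signWeight_eq_zero_of_not_odd (by simp) (by norm_num) h10 ha hx,
      signWeight_eq_zero_of_not_odd (by simp) (by norm_num) h10 hb hx]
    ring
  · by_contra hy
    refine h ?_
    rw [signWeight_eq_zero_of_not_odd (by simp) (by norm_num) h30 hc hy,
      signWeight_eq_zero_of_not_odd (by simp) (by norm_num) h30 hd hy,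
      signWeight_eq_zero_of_not_odd (by simp) (by norm_num) h30 he hy]
    ring

theorem hasSum_ten_thirty {r : ℂ} (hr0 : r ≠ 0) (hr : ‖r‖ < 1) (a b : ℤ) :
    HasSum (fun p : ℤ × ℤ => ((signWeight 60 3 10 a p.1 * signWeight 60 1 30 b p.2 : ℤ) : ℂ) *
      formTerm 3 0 1 r p) (signedTheta 10 a (r ^ 3) * signedTheta 30 b r) := by
  have h := hasSum_signedTheta_mul (N := 60) (s := 3) (t := 1) (M := 10) (M' := 30) (by simp)
    (by simp) (by norm_num) (by norm_num) (by simp) (by simp) a b hr (α := 3) (β := 1) (by simp)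
    (by simp) hr0
  simpa only [pow_one, Nat.cast_one, Nat.cast_ofNat] using h

/-- The quintuple product identity with base `q⁵` and parameter `q`, cleared of denominators. -/
theorem quintuple_G {q : ℂ} (hq0 : q ≠ 0) (hq : ‖q‖ < 1) :
    f (-q ^ 2) (-q ^ 3) * E (q ^ 5) = f (-q) (-q ^ 4) * thetaGG q := by
  obtain ⟨r, hr0, hr, rfl⟩ := exists_root hq0 hq (n := 120) (by simp)
  have h3 : r ^ 3 ≠ 0 := pow_ne_zero 3 hr0
  have h : HasSum (fun p : ℤ × ℤ => (quintupleWeightG p.1 p.2 : ℂ) * formTerm 3 0 1 r p) _ :=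
    ((hasSum_ten_thirty hr0 hr (-1) (-5)).sub ((hasSum_ten_thirty hr0 hr (-3) (-1)).add
      (hasSum_ten_thirty hr0 hr (-3) (-11)))).congr_fun fun p => by
        simp only [quintupleWeightG, weightGG]; push_cast; ring
  have h0 := eq_zero_of_hexagonalSum (d := fun x y => quintupleWeightG x (x + 2 * y))
    (hasSum_hexagonal (d := quintupleWeightG) h fun x y hxy =>
    odd_of_signWeight_combination (a := -1) (b := -3) (c := -5) (d := -1) (e := -11) (s := 1)
      (by decide) (by decide) (by decide) (by decide) (by decide)
      (by simpa only [quintupleWeightG, weightGG, one_mul] using hxy)) hexagonalSum_quintupleWeightG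
  rw [← mul_add, ← mul_thetaGG hr0, signedTheta_ten_neg_one h3, signedTheta_ten_neg_three h3,
    signedTheta_thirty_neg_five hr0, ← pow_mul r 3 40] at h0
  norm_num only at h0
  refine mul_left_cancel₀ (pow_ne_zero 28 hr0) ?_
  linear_combination h0

/-- The quintuple product identity with base `q⁵` and parameter `q²`, cleared of denominators. -/
theorem quintuple_H {q : ℂ} (hq0 : q ≠ 0) (hq : ‖q‖ < 1) :
    f (-q) (-q ^ 4) * E (q ^ 5) = f (-q ^ 2) (-q ^ 3) * thetaHH q := by
  obtain ⟨r, hr0, hr, rfl⟩ := exists_root hq0 hq (n := 120) (by simp)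
  have h3 : r ^ 3 ≠ 0 := pow_ne_zero 3 hr0
  have h : HasSum (fun p : ℤ × ℤ => (quintupleWeightH p.1 p.2 : ℂ) * formTerm 3 0 1 r p) _ :=
    ((hasSum_ten_thirty hr0 hr (-3) (-5)).sub ((hasSum_ten_thirty hr0 hr (-1) (-7)).sub
      (hasSum_ten_thirty hr0 hr (-1) (-13)))).congr_fun fun p => by
        simp only [quintupleWeightH, weightHH]; push_cast; ring
  have h0 := eq_zero_of_hexagonalSum (d := fun x y => quintupleWeightH x (x + 2 * y))
    (hasSum_hexagonal (d := quintupleWeightH) h fun x y hxy =>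
    odd_of_signWeight_combination (a := -3) (b := -1) (c := -5) (d := -7) (e := -13) (s := -1)
      (by decide) (by decide) (by decide) (by decide) (by decide)
      (by simpa only [quintupleWeightH, weightHH, neg_one_mul, ← sub_eq_add_neg] using hxy))
      hexagonalSum_quintupleWeightH
  rw [← mul_sub, ← mul_thetaHH hr0, signedTheta_ten_neg_one h3, signedTheta_ten_neg_three h3,
    signedTheta_thirty_neg_five hr0, ← pow_mul r 3 40] at h0
  norm_num only at h0
  refine mul_left_cancel₀ (pow_ne_zero 52 hr0) ?_
  linear_combination h0

theorem E_mul_G_mul_H {q : ℂ} (hq0 : q ≠ 0) (hq : ‖q‖ < 1) : E q * (G q * H q) = E (q ^ 5) := by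
  refine mul_left_cancel₀ (E_ne_zero hq0 hq) ?_
  linear_combination f_two_three_mul_f_one_four hq0 hq + f (-q) (-q ^ 4) * E_mul_G hq0 hq +
    E q * G q * E_mul_H hq0 hq

theorem f_one_four_ne_zero {q : ℂ} (hq0 : q ≠ 0) (hq : ‖q‖ < 1) : f (-q) (-q ^ 4) ≠ 0 :=
  right_ne_zero_of_mul (f_two_three_mul_f_one_four hq0 hq ▸ mul_ne_zero (E_ne_zero hq0 hq)
    (E_ne_zero (pow_ne_zero 5 hq0) (norm_pow_lt_one hq (by simp))))

theorem f_two_three_ne_zero {q : ℂ} (hq0 : q ≠ 0) (hq : ‖q‖ < 1) : f (-q ^ 2) (-q ^ 3) ≠ 0 :=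
  left_ne_zero_of_mul (f_two_three_mul_f_one_four hq0 hq ▸ mul_ne_zero (E_ne_zero hq0 hq)
    (E_ne_zero (pow_ne_zero 5 hq0) (norm_pow_lt_one hq (by simp))))

theorem E_mul_G_sq {q : ℂ} (hq0 : q ≠ 0) (hq : ‖q‖ < 1) : E q * G q ^ 2 = thetaGG q := by
  refine mul_left_cancel₀ (f_one_four_ne_zero hq0 hq) ?_
  rw [← quintuple_G hq0 hq, ← E_mul_G_mul_H hq0 hq, ← E_mul_G hq0 hq, ← E_mul_H hq0 hq]
  ring

theorem E_mul_H_sq {q : ℂ} (hq0 : q ≠ 0) (hq : ‖q‖ < 1) : E q * H q ^ 2 = thetaHH q := by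
  refine mul_left_cancel₀ (f_two_three_ne_zero hq0 hq) ?_
  rw [← quintuple_H hq0 hq, ← E_mul_G_mul_H hq0 hq, ← E_mul_G hq0 hq, ← E_mul_H hq0 hq]
  ring

/-! ### The lattice sums of discriminant `-71` -/

theorem hasSum_theta_mul {N : ℕ} {M : ℤ} (hN : (N : ℤ) = 2 * M) (hM : M ≠ 0) (a b : ℤ) {r : ℂ}
    (hr0 : r ≠ 0) (hr : ‖r‖ < 1) :
    HasSum (fun p : ℤ × ℤ => ((signWeight N 1 M a p.1 * signWeight N 1 M b p.2 : ℤ) : ℂ) *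
      formTerm 1 0 71 r p) (signedTheta M a r * signedTheta M b (r ^ 71)) := by
  have h := hasSum_signedTheta_mul (N := N) (s := 1) (t := 1) (M := M) (M' := M) (by simp)
    (by simp) (by simpa using hN) (by simpa using hN) hM hM a b hr (α := 1) (β := 71) (by simp)
    (by simp) hr0
  simpa only [pow_one, Nat.cast_one, Nat.cast_ofNat] using h

/-- The weights of `2 q³ E(q) E(q⁷¹)`, less those of the forms given by the classes `x = y` and
`x = 5 y`. -/
def weightEE (x y : ZMod (2 * 6)) : ℤ :=
  2 * (signWeight (2 * 6) 1 6 (-1) x * signWeight (2 * 6) 1 6 (-1) y) -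
    (classWeight 1 x y - classWeight 5 x y)

theorem weightEE_signs (x y : ZMod (2 * 6)) :
    weightEE x y + weightEE (-x) y + weightEE x (-y) + weightEE (-x) (-y) = 0 := by
  revert x y
  decide +kernel

theorem two_mul_E_mul_E {q : ℂ} (hq0 : q ≠ 0) (hq : ‖q‖ < 1) :
    2 * q ^ 3 * E q * E (q ^ 71) = form 3 1 6 q - form 4 3 5 q := by
  obtain ⟨r, hr0, hr, rfl⟩ := exists_root hq0 hq (n := 24) (by simp)
  have h1 := hasSum_classWeight (c := 6) (A := 3) (a := 1) (by simp) (by norm_num) hr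
  have h5 := hasSum_classWeight (c := 6) (A := 4) (a := 5) (by simp) (by norm_num) hr
  have h : HasSum (fun p : ℤ × ℤ => (weightEE p.1 p.2 : ℂ) * formTerm 1 0 71 r p) _ :=
    (((hasSum_theta_mul (N := 2 * 6) (M := 6) (by norm_num) (by simp) (-1) (-1) hr0 hr).mul_left
      2).sub (h1.sub h5)).congr_fun fun p => by rw [weightEE]; push_cast; ring
  have h0 := eq_zero_of_signs h weightEE_signs
  have e5 : form 4 5 6 (r ^ 24) = form 4 3 5 (r ^ 24) := by
    have := form_shear (-1) 4 5 6 (r ^ 24)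
    norm_num at this
    rw [← this, form_neg]
  rw [signedTheta_six hr0, signedTheta_six (pow_ne_zero 71 hr0), ← pow_mul r 71 24] at h0
  norm_num only [Nat.cast_ofNat] at h0
  rw [e5] at h0
  rw [← pow_mul r 24 71]
  linear_combination h0

/-- The weights of the theta products in `2 q² E(q) E(q⁷¹) U(1, 71, q)`, less those of the forms
given by the classes `x = 3 y` and `x = 7 y`. -/
def weightEEU (x y : ZMod (2 * 10)) : ℤ :=
  2 * (signWeight (2 * 10) 1 10 (-3) x * signWeight (2 * 10) 1 10 (-1) y -
    signWeight (2 * 10) 1 10 (-1) x * signWeight (2 * 10) 1 10 (-3) y) -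
    (classWeight 3 x y - classWeight 7 x y)

theorem weightEEU_signs (x y : ZMod (2 * 10)) :
    weightEEU x y + weightEEU (-x) y + weightEEU x (-y) + weightEEU (-x) (-y) = 0 := by
  revert x y
  decide +kernel

/-- By the Rogers-Ramanujan identities the left-hand side is `2 q² E(q) E(q⁷¹) U(1, 71, q)`. -/
theorem two_mul_theta_mul_theta {q : ℂ} (hq0 : q ≠ 0) (hq : ‖q‖ < 1) :
    2 * q ^ 2 * (f (-q) (-q ^ 4) * f (-(q ^ 71) ^ 2) (-(q ^ 71) ^ 3) -
      q ^ 14 * (f (-q ^ 2) (-q ^ 3) * f (-q ^ 71) (-(q ^ 71) ^ 4))) =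
      form 2 1 9 q - form 3 1 6 q := by
  obtain ⟨r, hr0, hr, rfl⟩ := exists_root hq0 hq (n := 40) (by simp)
  have h3 := hasSum_classWeight (c := 10) (A := 2) (a := 3) (by simp) (by norm_num) hr
  have h7 := hasSum_classWeight (c := 10) (A := 3) (a := 7) (by simp) (by norm_num) hr
  have hT := hasSum_theta_mul (N := 2 * 10) (M := 10) (by norm_num) (by simp) (r := r)
  have h : HasSum (fun p : ℤ × ℤ => (weightEEU p.1 p.2 : ℂ) * formTerm 1 0 71 r p) _ :=
    ((((hT (-3) (-1) hr0 hr).sub (hT (-1) (-3) hr0 hr)).mul_left 2).sub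
      (h3.sub h7)).congr_fun fun p => by rw [weightEEU]; push_cast; ring
  have h0 := eq_zero_of_signs h weightEEU_signs
  have e3 : form 2 3 10 (r ^ 40) = form 2 1 9 (r ^ 40) := by
    have := form_shear (-1) 2 3 10 (r ^ 40)
    norm_num at this
    rw [← this, form_neg]
  have e7 : form 3 7 10 (r ^ 40) = form 3 1 6 (r ^ 40) := by
    have := form_shear (-1) 3 7 10 (r ^ 40)
    norm_num at this
    rw [← this]
  have hr71 := pow_ne_zero 71 hr0
  rw [signedTheta_ten_neg_one hr0, signedTheta_ten_neg_three hr0, signedTheta_ten_neg_one hr71,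
    signedTheta_ten_neg_three hr71, ← pow_mul r 71 40] at h0
  norm_num only [Nat.cast_ofNat] at h0
  rw [e3, e7] at h0
  rw [← pow_mul r 40 71]
  norm_num only
  linear_combination h0

/-- The weights of the theta products in `2 q E(q) E(q⁷¹) U(1, 71, q)²`, less those of the forms
given by the classes `x = a y` for `a = 7, 13, 17, 23`. -/
def weightEEUU (x y : ZMod (2 * 30)) : ℤ :=
  2 * (weightHH x * weightGG y -
    2 * (signWeight (2 * 30) 1 30 (-5) x * signWeight (2 * 30) 1 30 (-5) y) +
    weightGG x * weightHH y) -
    (classWeight 17 x y - classWeight 23 x y - classWeight 13 x y + classWeight 7 x y)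

theorem weightEEUU_signs (x y : ZMod (2 * 30)) :
    weightEEUU x y + weightEEUU (-x) y + weightEEUU x (-y) + weightEEUU (-x) (-y) = 0 := by
  revert x y
  decide +kernel

/-- The left-hand side is the expansion of `2 q E(q) E(q⁷¹) U(1, 71, q)²`. -/
theorem two_mul_theta_squares {q : ℂ} (hq0 : q ≠ 0) (hq : ‖q‖ < 1) :
    2 * q * (thetaHH q * thetaGG (q ^ 71) - 2 * q ^ 14 * (E (q ^ 5) * E ((q ^ 71) ^ 5)) +
      q ^ 28 * (thetaGG q * thetaHH (q ^ 71))) =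
      form 3 1 6 q - form 4 3 5 q - form 2 1 9 q + form 1 1 18 q := by
  obtain ⟨r, hr0, hr, rfl⟩ := exists_root hq0 hq (n := 120) (by simp)
  have h7 := hasSum_classWeight (c := 30) (A := 1) (a := 7) (by simp) (by norm_num) hr
  have h13 := hasSum_classWeight (c := 30) (A := 2) (a := 13) (by simp) (by norm_num) hr
  have h17 := hasSum_classWeight (c := 30) (A := 3) (a := 17) (by simp) (by norm_num) hr
  have h23 := hasSum_classWeight (c := 30) (A := 5) (a := 23) (by simp) (by norm_num) hr
  have hT (a b : ℤ) :=
    hasSum_theta_mul (N := 2 * 30) (M := 30) (by norm_num) (by simp) a b hr0 hr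
  have hHG := ((hT (-7) (-1)).add (hT (-7) (-11))).sub ((hT (-13) (-1)).add (hT (-13) (-11)))
  have hGH := ((hT (-1) (-7)).add (hT (-11) (-7))).sub ((hT (-1) (-13)).add (hT (-11) (-13)))
  have h : HasSum (fun p : ℤ × ℤ => (weightEEUU p.1 p.2 : ℂ) * formTerm 1 0 71 r p) _ :=
    ((((hHG.sub ((hT (-5) (-5)).mul_left 2)).add hGH).mul_left 2).sub
      (((h17.sub h23).sub h13).add h7)).congr_fun fun p => by
        simp only [weightEEUU, weightGG, weightHH]; push_cast; ring
  have h0 := eq_zero_of_signs h weightEEUU_signs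
  have e7 : form 1 7 30 (r ^ 120) = form 1 1 18 (r ^ 120) := by
    have := form_shear (-3) 1 7 30 (r ^ 120)
    norm_num at this
    rw [← this]
  have e13 : form 2 13 30 (r ^ 120) = form 2 1 9 (r ^ 120) := by
    have := form_shear (-3) 2 13 30 (r ^ 120)
    norm_num at this
    rw [← this]
  have e17 : form 3 17 30 (r ^ 120) = form 3 1 6 (r ^ 120) := by
    have := form_shear (-3) 3 17 30 (r ^ 120)
    norm_num at this
    rw [← this, form_neg]
  have e23 : form 5 23 30 (r ^ 120) = form 4 3 5 (r ^ 120) := by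
    have := form_shear (-2) 5 23 30 (r ^ 120)
    norm_num at this
    rw [← this, form_swap]
  have hr71 := pow_ne_zero 71 hr0
  have g1 := mul_thetaGG hr0
  have g2 := mul_thetaGG hr71
  have g3 := mul_thetaHH hr0
  have g4 := mul_thetaHH hr71
  rw [signedTheta_thirty_neg_five hr0, signedTheta_thirty_neg_five hr71] at h0
  norm_num only [Nat.cast_ofNat] at h0
  rw [e7, e13, e17, e23] at h0
  rw [← pow_mul r 71 120] at g2 g4 h0
  rw [← pow_mul r 120 71]
  norm_num only at g2 g4 h0 ⊢
  linear_combination h0 + 2 * r ^ 49 * thetaHH (r ^ 120) * g2 +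
    2 * (signedTheta 30 (-1) (r ^ 71) + signedTheta 30 (-11) (r ^ 71)) * g3 +
    2 * r * thetaGG (r ^ 120) * g4 +
    2 * (signedTheta 30 (-7) (r ^ 71) - signedTheta 30 (-13) (r ^ 71)) * g1

/-! ### The terms of even exponent -/

theorem hasSum_ite_of_injective {t : ℤ × ℤ → ℂ} {S : ℂ} {g : ℤ × ℤ → ℤ × ℤ}
    (hg : Function.Injective g) {P : ℤ × ℤ → Prop} [DecidablePred P]
    (hP : ∀ p, P p ↔ p ∈ Set.range g) (h : HasSum (fun p => t (g p)) S) :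
    HasSum (fun p => if P p then t p else 0) S :=
  (hg.hasSum_iff fun p hp => if_neg fun h => hp ((hP p).1 h)).1
    (h.congr_fun fun p => if_pos ((hP (g p)).2 ⟨p, rfl⟩))

/-- The terms of even exponent, for a form with `a` and `b` odd and `c` even: the value at
`(n, m)` is even exactly when `n` or `n + m` is, and both conditions define a sublattice on which
the form is twice another form of the same discriminant. -/
theorem form_add_form_neg {a b c c' e : ℤ} (ha : Odd a) (hb : Odd b) (hc : c = 2 * c')
    (he : 2 * e = a - b + c) (hpos : 0 < a) (hd : b ^ 2 - 4 * a * c < 0) {q : ℂ} (hq : ‖q‖ < 1) :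
    form a b c q + form a b c (-q) =
      2 * (form (2 * a) b c' (q ^ 2) + form (2 * a) (b - 2 * a) e (q ^ 2) -
        form a b c (q ^ 4)) := by
  have hq2 := norm_pow_lt_one hq two_ne_zero
  have hq4 := norm_pow_lt_one hq four_ne_zero
  have h1 : HasSum (fun p : ℤ × ℤ => if Even p.1 then formTerm a b c q p else 0)
      (form (2 * a) b c' (q ^ 2)) := by
    refine hasSum_ite_of_injective (g := fun p => (2 * p.1, p.2)) (fun p p' h => ?_) (fun p => ?_)
      ((hasSum_form (by linarith) (by rw [hc] at hd; linarith) hq2).congr_fun fun p => ?_)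
    · simp only [Prod.mk.injEq] at h
      exact Prod.ext (by omega) h.2
    · rw [even_iff_two_dvd]
      exact ⟨fun ⟨k, hk⟩ => ⟨(k, p.2), Prod.ext hk.symm rfl⟩, fun ⟨p', h⟩ => ⟨p'.1, by rw [← h]⟩⟩
    · rw [formTerm, formTerm, ← zpow_natCast, ← zpow_mul]
      congr 1
      push_cast
      linear_combination p.2 ^ 2 * hc
  have h2 : HasSum (fun p : ℤ × ℤ => if Even (p.1 + p.2) then formTerm a b c q p else 0)
      (form (2 * a) (b - 2 * a) e (q ^ 2)) := by
    refine hasSum_ite_of_injective (g := fun p => (2 * p.1 - p.2, p.2)) (fun p p' h => ?_)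
      (fun p => ?_)
      ((hasSum_form (by linarith) (by linear_combination hd - 4 * a * he) hq2).congr_fun
        fun p => ?_)
    · simp only [Prod.mk.injEq] at h
      exact Prod.ext (by omega) h.2
    · rw [even_iff_two_dvd]
      exact ⟨fun ⟨k, hk⟩ => ⟨(k, p.2), Prod.ext (by simp only; omega) rfl⟩,
        fun ⟨p', h⟩ => ⟨p'.1, by rw [← h]; ring⟩⟩
    · rw [formTerm, formTerm, ← zpow_natCast, ← zpow_mul]
      congr 1
      push_cast
      linear_combination -p.2 ^ 2 * he
  have h3 : HasSum (fun p : ℤ × ℤ => if Even p.1 ∧ Even p.2 then formTerm a b c q p else 0)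
      (form a b c (q ^ 4)) := by
    refine hasSum_ite_of_injective (g := fun p => (2 * p.1, 2 * p.2)) (fun p p' h => ?_)
      (fun p => ?_) ((hasSum_form hpos hd hq4).congr_fun fun p => ?_)
    · simp only [Prod.mk.injEq] at h
      exact Prod.ext (by omega) (by omega)
    · rw [even_iff_two_dvd, even_iff_two_dvd]
      exact ⟨fun ⟨⟨k, hk⟩, ⟨l, hl⟩⟩ => ⟨(k, l), Prod.ext hk.symm hl.symm⟩,
        fun ⟨p', h⟩ => ⟨⟨p'.1, by rw [← h]⟩, ⟨p'.2, by rw [← h]⟩⟩⟩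
    · rw [formTerm, formTerm, ← zpow_natCast, ← zpow_mul]
      congr 1
      push_cast
      ring
  have hn : ‖-q‖ < 1 := by rwa [norm_neg]
  refine ((hasSum_form hpos hd hq).add (hasSum_form hpos hd hn)).unique
    ((((h1.add h2).sub h3).mul_left 2).congr_fun fun p => ?_)
  have hpar : Even (a * p.1 ^ 2 + b * p.1 * p.2 + c * p.2 ^ 2) ↔ Even p.1 ∨ Even (p.1 + p.2) := by
    have hc' : Even c := hc ▸ even_two_mul c'
    simp only [Int.even_add, Int.even_mul, Int.even_pow, Int.not_even_iff_odd.2 ha,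
      Int.not_even_iff_odd.2 hb, hc']
    tauto
  rcases Int.even_or_odd (a * p.1 ^ 2 + b * p.1 * p.2 + c * p.2 ^ 2) with h | h
  · rw [formTerm, formTerm, h.neg_zpow]
    rw [hpar] at h
    by_cases h5 : Even p.1 <;> by_cases h6 : Even p.2 <;>
      simp only [Int.even_add, h5, h6] at h ⊢ <;> simp <;> simp at h <;> ring
  · rw [formTerm, formTerm, h.neg_zpow]
    rw [← Int.not_even_iff_odd, hpar, not_or] at h
    simp [h.1, h.2]

theorem form_three_one_six_even {q : ℂ} (hq : ‖q‖ < 1) :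
    form 3 1 6 q + form 3 1 6 (-q) =
      2 * (form 3 1 6 (q ^ 2) + form 4 3 5 (q ^ 2) - form 3 1 6 (q ^ 4)) := by
  rw [form_add_form_neg (c' := 3) (e := 4) (by decide) (by decide) (by norm_num) (by norm_num)
    (by norm_num) (by norm_num) hq]
  have h1 := form_shear 1 4 (-5) 6 (q ^ 2)
  norm_num at h1 ⊢
  rw [form_swap 6 1 3, form_swap 6 (-5) 4, ← h1]

theorem form_four_three_five_even {q : ℂ} (hq : ‖q‖ < 1) :
    form 4 3 5 q + form 4 3 5 (-q) =
      2 * (form 2 1 9 (q ^ 2) + form 3 1 6 (q ^ 2) - form 4 3 5 (q ^ 4)) := by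
  rw [form_swap 4 3 5, form_swap 4 3 5, form_swap 4 3 5,
    form_add_form_neg (c' := 2) (e := 3) (by decide) (by decide) (by norm_num) (by norm_num)
    (by norm_num) (by norm_num) hq]
  have h1 := form_shear 1 3 (-7) 10 (q ^ 2)
  have h2 := form_shear (-1) 2 3 10 (q ^ 2)
  norm_num at h1 h2 ⊢
  rw [form_swap 10 3 2, form_swap 10 (-7) 3, ← h1, ← h2, form_neg, form_neg]

/-! ### The five identities -/

theorem form_zero {a b c : ℤ} (ha : 0 < a) (hd : b ^ 2 - 4 * a * c < 0) : form a b c 0 = 1 := by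
  rw [form, tsum_eq_single (0, 0)]
  · simp
  · rintro ⟨n, m⟩ hp
    refine zero_zpow _ fun h => hp ?_
    simp only at h
    have h1 : (2 * a * n + b * m) ^ 2 + (4 * a * c - b ^ 2) * m ^ 2 = 0 := by
      linear_combination 4 * a * h
    have hm : m = 0 := by
      by_contra hm
      nlinarith [sq_nonneg (2 * a * n + b * m), mul_pos (show 0 < 4 * a * c - b ^ 2 by linarith)
        (by positivity : 0 < m ^ 2)]
    subst hm
    have hn : n = 0 := by simpa [ha.ne'] using h
    rw [hn]

theorem U_one_seventyOne (q : ℂ) :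
    U 1 71 q = H q * G (q ^ 71) - q ^ 14 * (G q * H (q ^ 71)) := by
  rw [U, if_neg (by decide), if_pos (by decide), pow_one]
  norm_num

theorem E_mul_E_mul_U {q : ℂ} (hq0 : q ≠ 0) (hq : ‖q‖ < 1) :
    2 * q ^ 2 * E q * E (q ^ 71) * U 1 71 q = form 2 1 9 q - form 3 1 6 q := by
  have hQ0 := pow_ne_zero 71 hq0
  have hQ := norm_pow_lt_one hq (show 71 ≠ 0 by simp)
  rw [← two_mul_theta_mul_theta hq0 hq, ← E_mul_G hq0 hq, ← E_mul_H hq0 hq, ← E_mul_G hQ0 hQ,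
    ← E_mul_H hQ0 hQ, U_one_seventyOne]
  ring

theorem E_mul_E_mul_U_sq {q : ℂ} (hq0 : q ≠ 0) (hq : ‖q‖ < 1) :
    2 * q * E q * E (q ^ 71) * U 1 71 q ^ 2 =
      form 3 1 6 q - form 4 3 5 q - form 2 1 9 q + form 1 1 18 q := by
  have hQ0 := pow_ne_zero 71 hq0
  have hQ := norm_pow_lt_one hq (show 71 ≠ 0 by simp)
  rw [← two_mul_theta_squares hq0 hq, ← E_mul_G_sq hq0 hq, ← E_mul_H_sq hq0 hq, ← E_mul_G_sq hQ0 hQ,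
    ← E_mul_H_sq hQ0 hQ, ← E_mul_G_mul_H hq0 hq, ← E_mul_G_mul_H hQ0 hQ, U_one_seventyOne]
  ring

/-- After multiplication by `q³ E(q²) E(q¹⁴²)` every term is a difference of forms, and the
identity says how the even part of `(3, 1, 6) - (4, 3, 5)` splits. -/
theorem U_sq_eq_chi {q : ℂ} (hq0 : q ≠ 0) (hq : ‖q‖ < 1) :
    2 * q * U 1 71 (q ^ 2) = -2 * q ^ 3 + chi q * chi (q ^ 71) - chi (-q) * chi (-q ^ 71) -
      2 * q ^ 9 * (1 / (chi (-q ^ 2) * chi (-(q ^ 71) ^ 2))) := by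
  have hn0 : -q ≠ 0 := neg_ne_zero.2 hq0
  have hn : ‖-q‖ < 1 := by rwa [norm_neg]
  have hQ0 := pow_ne_zero 71 hq0
  have hQ := norm_pow_lt_one hq (show 71 ≠ 0 by simp)
  have hnQ0 : -q ^ 71 ≠ 0 := neg_ne_zero.2 hQ0
  have hnQ : ‖-q ^ 71‖ < 1 := by rwa [norm_neg]
  have hq2 := norm_pow_lt_one hq two_ne_zero
  have hQ2 := norm_pow_lt_one hQ two_ne_zero
  have h20 := pow_ne_zero 2 hq0
  have hQ20 := pow_ne_zero 2 hQ0
  -- `E(x²) χ(±x) = E(∓x)` for `x = q, q⁷¹`, and `E(x²) / χ(-x²) = E(x⁴)`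
  have c1 := chi_neg_mul_E_sq hq0 hq
  have c2 := chi_neg_mul_E_sq hn0 hn
  have c3 := chi_neg_mul_E_sq hQ0 hQ
  have c4 := chi_neg_mul_E_sq hnQ0 hnQ
  have c5 := chi_neg_mul_E_sq h20 hq2
  have c6 := chi_neg_mul_E_sq hQ20 hQ2
  rw [neg_neg, neg_sq] at c2 c4
  have x5 : chi (-q ^ 2) ≠ 0 := chi_ne_zero (by rwa [norm_neg])
  have x6 : chi (-(q ^ 71) ^ 2) ≠ 0 := chi_ne_zero (by rwa [norm_neg])
  -- the theta products as differences of forms, at `q`, `-q`, `q²` and `q⁴`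
  have f1 := two_mul_E_mul_E hq0 hq
  have f2 := two_mul_E_mul_E hn0 hn
  have f3 := two_mul_E_mul_E h20 hq2
  have f4 := two_mul_E_mul_E (pow_ne_zero 4 hq0) (norm_pow_lt_one hq four_ne_zero)
  have f5 := E_mul_E_mul_U h20 hq2
  have g1 := form_three_one_six_even hq
  have g2 := form_four_three_five_even hq
  have n71 : (-q) ^ 71 = -q ^ 71 := Odd.neg_pow (by decide) q
  have p2 : (q ^ 2) ^ 71 = (q ^ 71) ^ 2 := by ring
  have p4 : (q ^ 4) ^ 71 = ((q ^ 71) ^ 2) ^ 2 := by ring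
  have p4' : q ^ 4 = (q ^ 2) ^ 2 := by ring
  rw [n71] at f2
  rw [p2] at f3 f5
  rw [p4] at f4
  rw [show E (q ^ 4) = E ((q ^ 2) ^ 2) by rw [p4']] at f4
  have hE := E_ne_zero h20 hq2
  have hE' := E_ne_zero hQ20 hQ2
  have k : 1 / (chi (-q ^ 2) * chi (-(q ^ 71) ^ 2)) * (E (q ^ 2) * E ((q ^ 71) ^ 2)) =
      E ((q ^ 2) ^ 2) * E (((q ^ 71) ^ 2) ^ 2) := by
    rw [← c5, ← c6]
    generalize chi (-q ^ 2) = x at *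
    generalize chi (-(q ^ 71) ^ 2) = y at *
    field_simp
  refine mul_left_cancel₀ (mul_ne_zero (pow_ne_zero 3 hq0) (mul_ne_zero hE hE')) ?_
  have k1 : chi q * chi (q ^ 71) * (E (q ^ 2) * E ((q ^ 71) ^ 2)) = E (-q) * E (-q ^ 71) := by
    rw [← c2, ← c4]; ring
  have k2 : chi (-q) * chi (-q ^ 71) * (E (q ^ 2) * E ((q ^ 71) ^ 2)) = E q * E (q ^ 71) := by
    rw [← c1, ← c3]; ring
  linear_combination f5 - q ^ 3 * k1 + q ^ 3 * k2 + 2 * q ^ 12 * k + f3 + f4 + f1 / 2 + f2 / 2 +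
    g1 / 2 - g2 / 2

end

end RogersRamanujan

theorem mainTheorem4 (q Q : ℂ) (hq : ‖q‖ < 1) (hQ : Q = q ^ 71) :
    (2 * q ^ 3 * RogersRamanujan.E q * RogersRamanujan.E Q =
      RogersRamanujan.form 3 1 6 q - RogersRamanujan.form 4 3 5 q) ∧
    (2 * q * RogersRamanujan.E q * RogersRamanujan.E Q * RogersRamanujan.U 1 71 q ^ 2 =
      RogersRamanujan.form 3 1 6 q - RogersRamanujan.form 4 3 5 q
        - RogersRamanujan.form 2 1 9 q + RogersRamanujan.form 1 1 18 q) ∧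
    (2 * q ^ 2 * RogersRamanujan.E q * RogersRamanujan.E Q * RogersRamanujan.U 1 71 q =
      RogersRamanujan.form 2 1 9 q - RogersRamanujan.form 3 1 6 q) ∧
    (2 * q * RogersRamanujan.U 1 71 (q ^ 2) =
      -2 * q ^ 3 + RogersRamanujan.chi q * RogersRamanujan.chi Q
        - RogersRamanujan.chi (-q) * RogersRamanujan.chi (-Q)
        - 2 * q ^ 9 * (1 / (RogersRamanujan.chi (-q ^ 2) * RogersRamanujan.chi (-Q ^ 2)))) ∧
    ((RogersRamanujan.form 3 1 6 q - RogersRamanujan.form 4 3 5 q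
        - RogersRamanujan.form 2 1 9 q + RogersRamanujan.form 1 1 18 q)
        * (RogersRamanujan.form 3 1 6 q - RogersRamanujan.form 4 3 5 q) =
      (RogersRamanujan.form 2 1 9 q - RogersRamanujan.form 3 1 6 q) ^ 2) := by
  subst hQ
  rcases eq_or_ne q 0 with rfl | hq0
  · have h1 := RogersRamanujan.form_zero (a := 3) (b := 1) (c := 6) (by norm_num) (by norm_num)
    have h2 := RogersRamanujan.form_zero (a := 4) (b := 3) (c := 5) (by norm_num) (by norm_num)
    have h3 := RogersRamanujan.form_zero (a := 2) (b := 1) (c := 9) (by norm_num) (by norm_num)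
    have h4 := RogersRamanujan.form_zero (a := 1) (b := 1) (c := 18) (by norm_num) (by norm_num)
    simp [h1, h2, h3, h4]
  · have i1 := RogersRamanujan.two_mul_E_mul_E hq0 hq
    have i2 := RogersRamanujan.E_mul_E_mul_U_sq hq0 hq
    have i3 := RogersRamanujan.E_mul_E_mul_U hq0 hq
    refine ⟨i1, i2, i3, RogersRamanujan.U_sq_eq_chi hq0 hq, ?_⟩
    rw [← i2, ← i1, ← i3]
    ring
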